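/- **Setting.** Let $n>1$. The types of $Ty_n$ are built from the truth type $t$ and individual types $e_1,\dots,e_n$ by functional types $\alpha\beta$ (functions from $\alpha$ to $\beta$; association to the right) and product types $\alpha\times\beta$. Terms are built from variables $x^i_\alpha$ ($i\in\mathbb N$), non-logical constants and description operators $\iota_{(\alpha t)\alpha}$ by application, abstraction $\lambda x_\alpha A_\beta$, equality $A_\alpha=B_\alpha$ (of type $t$), pairs and projections; formulas are terms of type $t$. Connectives and quantifiers are defined from equality and abstraction as usual: $\top:=(\lambda x_t x_t=\lambda x_t x_t)$, $\forall x_\alpha A:=(\lambda x_\alpha\top=\lambda x_\alpha A)$, $\bot:=\forall x_t\,x_t$, $\neg A:=(\bot=A)$, $A\wedge B:=(\lambda x_t\lambda y_t(\lambda g_{ttt}\,g\top\top=\lambda g_{ttt}\,g\,x_t\,y_t))AB$, $A\vee B:=\neg(\neg A\wedge\neg B)$, $A\to B:=(A=(A\wedge B))$. The logical axioms are all instances of $(G\top\wedge G\bot)=\forall x_t(Gx_t)$; $A=B\to HA=HB$ ($H$ of type $\alpha t$); $(F=G)=\forall x_\alpha(Fx_\alpha=Gx_\alpha)$; $(\lambda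 x_\alpha A)B=A[B/x_\alpha]$ with $B$ free for $x_\alpha$ in $A$; $\iota(\lambda x_\alpha(A=x_\alpha))=A$; $\pi_1(A,B)=A$; $\pi_2(A,B)=B$; $(\pi_1A,\pi_2A)=A$ (where the variable bound in the first, third and fifth schema is not free in $G$; in $F,G$; in $A$). The only rule is: from $A=B$ and $\varphi$ infer the result of replacing one occurrence of $A$ in $\varphi$ by $B$. For a set $\Delta$ of formulas, $\Delta\vdash\varphi$ means that $\psi_1\to\dots\to\psi_k\to\varphi$ is a theorem for some $\psi_1,\dots,\psi_k\in\Delta$ (free variables of $\Delta$ are not generalized), and $\Delta$ is consistent if $\Delta\not\vdash\bot$. Let $\mathcal A=\{a_1,\dots,a_N\}$ be a finite alphabet and $s:=e_n$. Suppose that $Ty_n$ has (besides arbitrary other non-logical constants) distinct constants $\mathbf C^0_{sss}$ and $\mathbf C^0_s,\dots,\mathbf C^N_s$; write $A+B$ for $\mathbf C^0_{sss}AB$. $Ty_n^{\mathcal A}$ is the extension of $Ty_n$ by the axioms $$\forall x_s(x_s+\mathbf C^0_s=x_s\wedge \mathbf C^0_s+x_s=x_s),\qquad \forall x_s\forall y_s\forall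 z_s((x_s+y_s)+z_s=x_s+(y_s+z_s)),$$ $$\forall x_s\forall y_s\forall z_s(x_s+\mathbf C^i_s+y_s\ne x_s+\mathbf C^j_s+z_s)\qquad(1\le i<j\le N).$$ For words put $T_A(\varepsilon)=\mathbf C^0_s$, $T_A(a_i)=\mathbf C^i_s$, $T_A(a_iw)=\mathbf C^i_s+T_A(w)$ for $w\neq\varepsilon$. An *$\alpha$-language* is a set $\mathcal L$ of pairs $(w,A_\alpha)$ of a word $w\in\mathcal A^*$ and a term $A_\alpha$ of $Ty_n^{\mathcal A}$ of type $\alpha$ (free variables are allowed). It is *logically closed* if whenever $(w,B_\alpha),(w,C_\alpha)\in\mathcal L$ and $A_\alpha=B_\alpha\vee A_\alpha=C_\alpha$ is a theorem of $Ty_n^{\mathcal A}$, then $(w,A_\alpha)\in\mathcal L$. Let $Ty_n^{\mathcal A+}$ be an extension of $Ty_n^{\mathcal A}$ by additional non-logical constants. $\mathcal L$ is *represented by* $(\Delta,L_{s\alpha t})$, where $\Delta$ is a consistent set of $Ty_n^{\mathcal A+}$ formulas and $L_{s\alpha t}$ a $Ty_n^{\mathcal A+}$ term, if for all words $w$ and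 all $Ty_n^{\mathcal A}$ terms $A_\alpha$ $$(w,A_\alpha)\in\mathcal L\iff\Delta\vdash L_{s\alpha t}\;T_A(w)\;A_\alpha\quad\text{in }Ty_n^{\mathcal A+}.$$ $\mathcal L$ is *$Ty_n$-representable* if it is represented by some $(\Delta,L_{s\alpha t})$ in some such extension. **Theorem.** Let $\mathcal L$ be an $\alpha$-language. 1. If $\mathcal L$ is $Ty_n$-representable, then it is logically closed. 2. Suppose $N\ne1$. If $\mathcal L$ is logically closed and $Ty_n^{\mathcal A+}$ is any extension of $Ty_n^{\mathcal A}$ by additional constants which include a constant $\mathbf C$ of type $s\alpha t$ that does not belong to $Ty_n^{\mathcal A}$, then $\Delta_{\mathcal L}:=\{\mathbf C\;T_A(w)\;A_\alpha : (w,A_\alpha)\in\mathcal L\}$ is consistent and $(\Delta_{\mathcal L},\mathbf C)$ represents $\mathcal L$. 3. Consequently, if $N\neq1$, then $\mathcal L$ is $Ty_n$-representable if and only if it is logically closed. -/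

import Mathlib

universe u v

namespace TyN

/-- Types of `Ty_n`: the truth type `t`, individual types of `n` sorts, functional types
`fn α β` (from `α` to `β`) and product types. -/
inductive Ty (n : ℕ) : Type where
  | t : Ty n
  | e : Fin n → Ty n
  | fn : Ty n → Ty n → Ty n
  | prod : Ty n → Ty n → Ty n
  deriving DecidableEq

/-- Terms of `Ty_n`, where `C α` is the set of non-logical constants of type `α`. The variables of
type `α` are `var i α` with `i : ℕ`; two variables are the same iff both the index and the type
agree. `iota α` is the description operator. -/
inductive Term {n : ℕ} (C : Ty n → Type u) : Ty n → Type u where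
  | var (i : ℕ) (α : Ty n) : Term C α
  | const {α : Ty n} (c : C α) : Term C α
  | iota (α : Ty n) : Term C (Ty.fn (Ty.fn α Ty.t) α)
  | app {α β : Ty n} (A : Term C (Ty.fn α β)) (B : Term C α) : Term C β
  | lam (i : ℕ) (α : Ty n) {β : Ty n} (A : Term C β) : Term C (Ty.fn α β)
  | eq {α : Ty n} (A B : Term C α) : Term C Ty.t
  | pair {α β : Ty n} (A : Term C α) (B : Term C β) : Term C (Ty.prod α β)
  | fst {α β : Ty n} (A : Term C (Ty.prod α β)) : Term C α
  | snd {α β : Ty n} (A : Term C (Ty.prod α β)) : Term C β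

/-- Formulas are terms of type `t`. -/
abbrev Form {n : ℕ} (C : Ty n → Type u) : Type u := Term C Ty.t

namespace Term

variable {n : ℕ} {C : Ty n → Type u}

/-- Renaming of the non-logical constants. -/
def map {D : Ty n → Type v} (f : ∀ α : Ty n, C α → D α) : {β : Ty n} → Term C β → Term D β
  | _, var i α => var i α
  | _, const c => const (f _ c)
  | _, iota α => iota α
  | _, app A B => app (map f A) (map f B)
  | _, lam i α A => lam i α (map f A)
  | _, eq A B => eq (map f A) (map f B)
  | _, pair A B => pair (map f A) (map f B)
  | _, fst A => fst (map f A)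
  | _, snd A => snd (map f A)

/-- `Free i α A`: the variable `var i α` occurs free in `A`. -/
def Free (i : ℕ) (α : Ty n) : {β : Ty n} → Term C β → Prop
  | _, var j γ => j = i ∧ γ = α
  | _, const _ => False
  | _, iota _ => False
  | _, app A B => Free i α A ∨ Free i α B
  | _, lam j γ A => ¬ (j = i ∧ γ = α) ∧ Free i α A
  | _, eq A B => Free i α A ∨ Free i α B
  | _, pair A B => Free i α A ∨ Free i α B
  | _, fst A => Free i α A
  | _, snd A => Free i α A

/-- `subst i B A` replaces all free occurrences of the variable `var i α` in `A` by `B`. Bound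
variables are not renamed, so it is used only together with `FreeFor`. -/
def subst (i : ℕ) {α : Ty n} (B : Term C α) : {β : Ty n} → Term C β → Term C β
  | _, var j γ => if h : j = i ∧ α = γ then h.2 ▸ B else var j γ
  | _, const c => const c
  | _, iota γ => iota γ
  | _, app A A' => app (subst i B A) (subst i B A')
  | _, lam j γ A => if j = i ∧ γ = α then lam j γ A else lam j γ (subst i B A)
  | _, eq A A' => eq (subst i B A) (subst i B A')
  | _, pair A A' => pair (subst i B A) (subst i B A')
  | _, fst A => fst (subst i B A)
  | _, snd A => snd (subst i B A)

/-- `FreeFor i B A`: the term `B` is free for the variable `var i α` in `A`, i.e. no free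
occurrence of that variable in `A` is in the scope of an abstraction over a variable that is free
in `B`. -/
def FreeFor (i : ℕ) {α : Ty n} (B : Term C α) : {β : Ty n} → Term C β → Prop
  | _, var _ _ => True
  | _, const _ => True
  | _, iota _ => True
  | _, app A A' => FreeFor i B A ∧ FreeFor i B A'
  | _, lam j γ A => (j = i ∧ γ = α) ∨ ¬ Free i α A ∨ (¬ Free j γ B ∧ FreeFor i B A)
  | _, eq A A' => FreeFor i B A ∧ FreeFor i B A'
  | _, pair A A' => FreeFor i B A ∧ FreeFor i B A'
  | _, fst A => FreeFor i B A
  | _, snd A => FreeFor i B A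

/-- `Replace A B P Q`: `Q` results from `P` by replacing one occurrence of `A` by `B`. (The
variable of an abstraction is not an occurrence of a term; occurrences in the scope of an
abstraction may be replaced.) -/
inductive Replace {α : Ty n} (A B : Term C α) : {β : Ty n} → Term C β → Term C β → Prop
  | here : Replace A B A B
  | appL {β γ : Ty n} {P P' : Term C (Ty.fn β γ)} (Q : Term C β) :
      Replace A B P P' → Replace A B (app P Q) (app P' Q)
  | appR {β γ : Ty n} (P : Term C (Ty.fn β γ)) {Q Q' : Term C β} :
      Replace A B Q Q' → Replace A B (app P Q) (app P Q')
  | lam (i : ℕ) (γ : Ty n) {β : Ty n} {P P' : Term C β} :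
      Replace A B P P' → Replace A B (lam i γ P) (lam i γ P')
  | eqL {β : Ty n} {P P' : Term C β} (Q : Term C β) :
      Replace A B P P' → Replace A B (eq P Q) (eq P' Q)
  | eqR {β : Ty n} (P : Term C β) {Q Q' : Term C β} :
      Replace A B Q Q' → Replace A B (eq P Q) (eq P Q')
  | pairL {β γ : Ty n} {P P' : Term C β} (Q : Term C γ) :
      Replace A B P P' → Replace A B (pair P Q) (pair P' Q)
  | pairR {β γ : Ty n} (P : Term C β) {Q Q' : Term C γ} :
      Replace A B Q Q' → Replace A B (pair P Q) (pair P Q')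
  | fst {β γ : Ty n} {P P' : Term C (Ty.prod β γ)} :
      Replace A B P P' → Replace A B (fst P) (fst P')
  | snd {β γ : Ty n} {P P' : Term C (Ty.prod β γ)} :
      Replace A B P P' → Replace A B (snd P) (snd P')

/-! Logical symbols, defined from equality and abstraction as in the systems of Gallin and
Andrews. -/

/-- Truth: `λ x_t. x_t = λ x_t. x_t`. -/
def tru : Form C := eq (lam 0 Ty.t (var 0 Ty.t)) (lam 0 Ty.t (var 0 Ty.t))

/-- `∀ x_α. A`, i.e. `λ x_α. ⊤ = λ x_α. A`, where `x_α` is `var i α`. -/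
def all (i : ℕ) (α : Ty n) (A : Form C) : Form C := eq (lam i α tru) (lam i α A)

/-- Falsity: `∀ x_t. x_t`. -/
def fls : Form C := all 0 Ty.t (var 0 Ty.t)

/-- Negation: `⊥ = A`. -/
def neg (A : Form C) : Form C := eq fls A

/-- Conjunction as a closed term: `λ x_t. λ y_t. (λ g_ttt. g ⊤ ⊤) = (λ g_ttt. g x_t y_t)`. -/
def conjOp : Term C (Ty.fn Ty.t (Ty.fn Ty.t Ty.t)) :=
  lam 0 Ty.t (lam 1 Ty.t
    (eq (lam 0 (Ty.fn Ty.t (Ty.fn Ty.t Ty.t))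
          (app (app (var 0 (Ty.fn Ty.t (Ty.fn Ty.t Ty.t))) tru) tru))
        (lam 0 (Ty.fn Ty.t (Ty.fn Ty.t Ty.t))
          (app (app (var 0 (Ty.fn Ty.t (Ty.fn Ty.t Ty.t))) (var 0 Ty.t)) (var 1 Ty.t)))))

/-- Conjunction. -/
def conj (A B : Form C) : Form C := app (app conjOp A) B

/-- Disjunction: `¬ (¬ A ∧ ¬ B)`. -/
def disj (A B : Form C) : Form C := neg (conj (neg A) (neg B))

/-- Implication: `A = (A ∧ B)`. -/
def imp (A B : Form C) : Form C := eq A (conj A B)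

end Term

open Term

section Calculus

variable {n : ℕ} {C : Ty n → Type u}

/-- `Thm Ax φ`: the formula `φ` is a theorem of `Ty_n` with the non-logical axioms `Ax`. -/
inductive Thm (Ax : Set (Form C)) : Form C → Prop
  /-- non-logical axioms -/
  | nonlogical {φ : Form C} : φ ∈ Ax → Thm Ax φ
  /-- `(G ⊤ ∧ G ⊥) = ∀ x_t. G x_t` -/
  | truthValues (i : ℕ) (G : Term C (Ty.fn Ty.t Ty.t)) : ¬ Free i Ty.t G →
      Thm Ax (eq (conj (app G tru) (app G fls)) (all i Ty.t (app G (var i Ty.t))))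
  /-- `A = B → H A = H B` -/
  | leibniz {α : Ty n} (A B : Term C α) (H : Term C (Ty.fn α Ty.t)) :
      Thm Ax (imp (eq A B) (eq (app H A) (app H B)))
  /-- `(F = G) = ∀ x_α. F x_α = G x_α` -/
  | extensionality {α β : Ty n} (i : ℕ) (F G : Term C (Ty.fn α β)) :
      ¬ Free i α F → ¬ Free i α G →
      Thm Ax (eq (eq F G) (all i α (eq (app F (var i α)) (app G (var i α)))))
  /-- `(λ x_α. A) B = A(B)` -/
  | beta {α β : Ty n} (i : ℕ) (A : Term C β) (B : Term C α) : FreeFor i B A →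
      Thm Ax (eq (app (lam i α A) B) (subst i B A))
  /-- `ι (λ x_α. A = x_α) = A` -/
  | description {α : Ty n} (i : ℕ) (A : Term C α) : ¬ Free i α A →
      Thm Ax (eq (app (iota α) (lam i α (eq A (var i α)))) A)
  /-- `π₁ (A, B) = A` -/
  | fstPair {α β : Ty n} (A : Term C α) (B : Term C β) : Thm Ax (eq (fst (pair A B)) A)
  /-- `π₂ (A, B) = B` -/
  | sndPair {α β : Ty n} (A : Term C α) (B : Term C β) : Thm Ax (eq (snd (pair A B)) B)
  /-- `(π₁ A, π₂ A) = A` -/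
  | pairProj {α β : Ty n} (A : Term C (Ty.prod α β)) : Thm Ax (eq (pair (fst A) (snd A)) A)
  /-- The rule of inference: replacement of one occurrence of a term by a provably equal term. -/
  | replace {α : Ty n} {A B : Term C α} {φ ψ : Form C} :
      Thm Ax (eq A B) → Thm Ax φ → Replace A B φ ψ → Thm Ax ψ

/-- `Δ ⊢ φ` in the theory with the non-logical axioms `Ax`: for some `ψ₁, …, ψₖ ∈ Δ` the formula
`ψ₁ → … → ψₖ → φ` is a theorem. Members of `Δ` may have free variables, which are not generalized
in a derivation. -/
def Derives (Ax Δ : Set (Form C)) (φ : Form C) : Prop :=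
  ∃ l : List (Form C), (∀ ψ ∈ l, ψ ∈ Δ) ∧ Thm Ax (l.foldr imp φ)

/-- `Δ` is consistent in the theory with the non-logical axioms `Ax`. -/
def Consistent (Ax Δ : Set (Form C)) : Prop := ¬ Derives Ax Δ fls

end Calculus

section Symbolic

variable {n : ℕ} [NeZero n]

/-- The symbolic type `s`, the last individual type `e_n`. -/
abbrev symb (n : ℕ) [NeZero n] : Ty n := Ty.e ⟨n - 1, Nat.sub_lt (NeZero.pos n) Nat.one_pos⟩

/-- The non-logical constants of `Ty_n` over an alphabet of `N` symbols: concatenation, the empty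
word, one constant for each symbol, and arbitrary further constants `K`. -/
inductive SymConst (N : ℕ) (K : Ty n → Type u) : Ty n → Type u where
  | cat : SymConst N K (Ty.fn (symb n) (Ty.fn (symb n) (symb n)))
  | eps : SymConst N K (symb n)
  | letter (i : Fin N) : SymConst N K (symb n)
  | other {α : Ty n} (k : K α) : SymConst N K α

variable {N : ℕ} {K : Ty n → Type u}

/-- The empty-word constant. -/
def epsT : Term (SymConst N K) (symb n) := const SymConst.eps

/-- The constant of the `i`-th symbol of the alphabet. -/
def letterT (i : Fin N) : Term (SymConst N K) (symb n) := const (SymConst.letter i)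

/-- Concatenation `A + B` of terms of type `s`. -/
def catT (A B : Term (SymConst N K) (symb n)) : Term (SymConst N K) (symb n) :=
  app (app (const SymConst.cat) A) B

/-- The non-logical axioms that extend `Ty_n` to the theory of the symbolic type. -/
inductive SymAx (N : ℕ) (K : Ty n → Type u) : Form (SymConst N K) → Prop
  /-- `∀ x (x + ε = x ∧ ε + x = x)` -/
  | unit : SymAx N K (all 0 (symb n)
      (conj (eq (catT (var 0 _) epsT) (var 0 _)) (eq (catT epsT (var 0 _)) (var 0 _))))
  /-- `∀ x y z ((x + y) + z = x + (y + z))` -/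
  | assoc : SymAx N K (all 0 (symb n) (all 1 (symb n) (all 2 (symb n)
      (eq (catT (catT (var 0 _) (var 1 _)) (var 2 _))
          (catT (var 0 _) (catT (var 1 _) (var 2 _)))))))
  /-- `∀ x y z (x + aᵢ + y ≠ x + aⱼ + z)` for `i < j` -/
  | distinct (i j : Fin N) : i < j → SymAx N K (all 0 (symb n) (all 1 (symb n) (all 2 (symb n)
      (neg (eq (catT (catT (var 0 _) (letterT i)) (var 1 _))
               (catT (catT (var 0 _) (letterT j)) (var 2 _)))))))

/-- The set of the axioms of the symbolic type. -/
def symAxioms (N : ℕ) (K : Ty n → Type u) : Set (Form (SymConst N K)) := {φ | SymAx N K φ}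

/-- The term `T_A(w)` of type `s` that denotes the word `w`. -/
def wordT : List (Fin N) → Term (SymConst N K) (symb n)
  | [] => epsT
  | [a] => letterT a
  | a :: b :: w => catT (letterT a) (wordT (b :: w))

/-- An `α`-language: a relation between words over the alphabet and terms of type `α`. -/
abbrev Lang (N : ℕ) (K : Ty n → Type u) (α : Ty n) : Type u :=
  Set (List (Fin N) × Term (SymConst N K) α)

/-- Logically closed `α`-languages. -/
def LogicallyClosed {α : Ty n} (L : Lang N K α) : Prop :=
  ∀ (w : List (Fin N)) (A B D : Term (SymConst N K) α), (w, B) ∈ L → (w, D) ∈ L →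
    Thm (symAxioms N K) (disj (eq A B) (eq A D)) → (w, A) ∈ L

/-- The constants of an extension by additional non-logical constants `E`. -/
abbrev ExtConst (N : ℕ) (K : Ty n → Type u) (E : Ty n → Type v) : Ty n → Type (max u v) :=
  fun α => SymConst N K α ⊕ E α

/-- The inclusion of the terms into the terms of an extension. -/
def lift (E : Ty n → Type v) {α : Ty n} (A : Term (SymConst N K) α) : Term (ExtConst N K E) α :=
  A.map fun _ c => Sum.inl c

/-- The axioms of the symbolic type as formulas of an extension. -/
def extAxioms (N : ℕ) (K : Ty n → Type u) (E : Ty n → Type v) : Set (Form (ExtConst N K E)) :=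
  lift E '' symAxioms N K

/-- The language `L` is represented by `(Δ, R)`, with `Δ` a consistent set of formulas and `R` a
term of type `sαt` of the extension by the constants `E`. -/
def RepresentedBy (E : Ty n → Type v) {α : Ty n} (Δ : Set (Form (ExtConst N K E)))
    (R : Term (ExtConst N K E) (Ty.fn (symb n) (Ty.fn α Ty.t))) (L : Lang N K α) : Prop :=
  Consistent (extAxioms N K E) Δ ∧
    ∀ (w : List (Fin N)) (A : Term (SymConst N K) α),
      (w, A) ∈ L ↔ Derives (extAxioms N K E) Δ (app (app R (lift E (wordT w))) (lift E A))

/-- `Ty_n`-representable `α`-languages. -/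
def Representable {α : Ty n} (L : Lang N K α) : Prop :=
  ∃ (E : Ty n → Type v) (Δ : Set (Form (ExtConst N K E)))
    (R : Term (ExtConst N K E) (Ty.fn (symb n) (Ty.fn α Ty.t))), RepresentedBy E Δ R L

/-- The set of the formulas `c T_A(w) A` with `(w, A) ∈ L`, where `c` is an additional constant of
type `sαt`. -/
def langAxioms (E : Ty n → Type v) {α : Ty n} (c : E (Ty.fn (symb n) (Ty.fn α Ty.t)))
    (L : Lang N K α) : Set (Form (ExtConst N K E)) :=
  {φ | ∃ (w : List (Fin N)) (A : Term (SymConst N K) α), (w, A) ∈ L ∧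
    φ = app (app (const (Sum.inr c)) (lift E (wordT w))) (lift E A)}

end Symbolic

end TyN

/-!
Part 1 is Leibniz' law applied under the premises `Δ`.

For part 2, a derivation of `φ` from premises `C (T wᵢ) Aᵢ` remains one when the new constant `C` is
read as a variable, and that variable can be instantiated by the graph of the finite relation
`{(T wᵢ, Aᵢ)}`. All premises become theorems, so `φ` with `C` replaced by the graph is a theorem.
For `φ = ⊥` this contradicts the consistency of the word axioms, whose standard model consists of
the words. For `φ = C (T w) A` it says that `(T w, A)` is provably one of the pairs `(T wᵢ, Aᵢ)`.
If `N ≠ 1`, then `T w ≠ T wᵢ` is a theorem whenever `w ≠ wᵢ`: a suitable letter appended to both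
words makes them differ at a common position. Hence `A` is provably one of the `Aᵢ` with `wᵢ = w`.

Logical closure speaks of two alternatives only; it passes to finitely many because
`A = B₁ ∨ A = B₂ ∨ …` gives `Z = B₂ ∨ …` and `A = B₁ ∨ A = Z` for `Z := if A = B₁ then B₂ else A`.
-/

namespace TyN

namespace Term

variable {n : ℕ} {C : Ty n → Type u}

/-- A strict upper bound for the indices of the variables of a term, free or bound; variables with
larger indices serve as fresh variables. -/
def varBound : {β : Ty n} → Term C β → ℕ
  | _, var i _ => i + 1
  | _, const _ => 0
  | _, iota _ => 0
  | _, app A B => max (varBound A) (varBound B)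
  | _, lam i _ A => max (i + 1) (varBound A)
  | _, eq A B => max (varBound A) (varBound B)
  | _, pair A B => max (varBound A) (varBound B)
  | _, fst A => varBound A
  | _, snd A => varBound A

theorem not_free_of_varBound_le {i : ℕ} {α β : Ty n} {A : Term C β} (h : varBound A ≤ i) :
    ¬ Free i α A := by
  induction A with
  | var j γ => simp only [varBound] at h; simp only [Free]; omega
  | _ => simp_all [varBound, Free]

theorem exists_varBound_le {β : Ty n} {S : Set (Term C β)} (hS : S.Finite) :
    ∃ m, ∀ A ∈ S, varBound A ≤ m := by
  obtain ⟨m, hm⟩ := (hS.image varBound).bddAbove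
  exact ⟨m, fun A hA => hm ⟨A, hA, rfl⟩⟩

/-- Closed terms: no variable occurs free. -/
def Closed {β : Ty n} (A : Term C β) : Prop := ∀ (i : ℕ) (α : Ty n), ¬ Free i α A

section Substitution

variable {i : ℕ} {α β : Ty n} {B : Term C α} {A : Term C β}

@[simp] theorem subst_var_same (i : ℕ) (B : Term C α) : subst i B (var i α) = B := by
  simp [subst]

theorem subst_of_not_free (h : ¬ Free i α A) : subst i B A = A := by
  induction A with
  | var j γ => exact dif_neg fun hj => h ⟨hj.1, hj.2.symm⟩
  | lam j γ A ih => simp only [Free, not_and] at h; simp only [subst]; grind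
  | _ => simp_all [Free, subst]

theorem freeFor_of_not_free (h : ¬ Free i α A) : FreeFor i B A := by
  induction A with
  | lam j γ A _ => simp only [Free] at h; simp only [FreeFor]; tauto
  | _ => simp_all [Free, FreeFor]

theorem Closed.freeFor (hB : Closed B) : FreeFor i B A := by
  induction A with
  | lam j γ A ih => exact .inr (.inr ⟨hB j γ, ih⟩)
  | _ => simp_all [FreeFor]

theorem Closed.subst_eq (hA : Closed A) : subst i B A = A := subst_of_not_free (hA i α)

theorem subst_var_self (i : ℕ) (α : Ty n) (A : Term C β) : subst i (var i α) A = A := by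
  induction A with
  | var j γ =>
    simp only [subst]
    split_ifs with h
    · obtain ⟨rfl, rfl⟩ := h; rfl
    · rfl
  | _ => simp_all [subst]

theorem freeFor_var_self (i : ℕ) (α : Ty n) (A : Term C β) : FreeFor i (var i α) A := by
  induction A with
  | lam j γ A ih => simp only [FreeFor, Free]; grind
  | _ => simp_all [FreeFor]

end Substitution

section LogicalSymbols

theorem closed_tru : Closed (tru : Form C) := by simp [Closed, tru, Free]

theorem closed_fls : Closed (fls : Form C) := by simp [Closed, fls, all, tru, Free]

theorem closed_conjOp : Closed (conjOp : Term C (Ty.fn Ty.t (Ty.fn Ty.t Ty.t))) := by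
  intro i α
  simp only [conjOp, tru, Free]
  grind

variable (i : ℕ) {α : Ty n} (B : Term C α) (P Q : Form C)

@[simp] theorem subst_tru : subst i B (tru : Form C) = tru := closed_tru.subst_eq

@[simp] theorem subst_fls : subst i B (fls : Form C) = fls := closed_fls.subst_eq

@[simp] theorem subst_neg : subst i B (neg P) = neg (subst i B P) := by simp [neg, subst]

@[simp] theorem subst_conj : subst i B (conj P Q) = conj (subst i B P) (subst i B Q) := by
  simp [conj, subst, closed_conjOp.subst_eq]

@[simp] theorem subst_disj : subst i B (disj P Q) = disj (subst i B P) (subst i B Q) := by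
  simp [disj]

@[simp] theorem subst_imp : subst i B (imp P Q) = imp (subst i B P) (subst i B Q) := by
  simp [imp, subst]

theorem subst_foldr_imp (l : List (Form C)) :
    subst i B (l.foldr imp P) = (l.map (subst i B)).foldr imp (subst i B P) := by
  induction l with
  | nil => rfl
  | cons Q l ih => simp [ih]

@[simp] theorem freeFor_tru : FreeFor i B (tru : Form C) := freeFor_of_not_free (closed_tru i α)

@[simp] theorem freeFor_fls : FreeFor i B (fls : Form C) := freeFor_of_not_free (closed_fls i α)

@[simp] theorem freeFor_neg : FreeFor i B (neg P) ↔ FreeFor i B P := by simp [neg, FreeFor]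

@[simp] theorem freeFor_conj : FreeFor i B (conj P Q) ↔ FreeFor i B P ∧ FreeFor i B Q := by
  simp [conj, FreeFor, freeFor_of_not_free (closed_conjOp i α)]

@[simp] theorem freeFor_disj : FreeFor i B (disj P Q) ↔ FreeFor i B P ∧ FreeFor i B Q := by
  simp [disj]

@[simp] theorem freeFor_imp : FreeFor i B (imp P Q) ↔ FreeFor i B P ∧ FreeFor i B Q := by
  simp only [imp, FreeFor, freeFor_conj]
  tauto

theorem freeFor_foldr_imp (l : List (Form C)) :
    FreeFor i B (l.foldr imp P) ↔ (∀ Q ∈ l, FreeFor i B Q) ∧ FreeFor i B P := by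
  induction l with
  | nil => simp
  | cons Q l ih => simp [ih, and_assoc]

end LogicalSymbols

end Term

open Term

namespace Thm

variable {n : ℕ} {C : Ty n → Type u} {Ax : Set (Form C)} {α β : Ty n}

section Equality

theorem beta_var (i : ℕ) (A : Term C α) : Thm Ax (eq (app (lam i α (var i α)) A) A) := by
  simpa only [subst_var_same] using Thm.beta (Ax := Ax) i (var i α) A trivial

theorem refl (A : Term C α) : Thm Ax (eq A A) :=
  replace (beta_var 0 A) (beta_var 0 A) (.eqL _ .here)

theorem symm {A B : Term C α} (h : Thm Ax (eq A B)) : Thm Ax (eq B A) :=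
  replace h (refl A) (.eqL _ .here)

theorem trans {A B D : Term C α} (h : Thm Ax (eq A B)) (h' : Thm Ax (eq B D)) :
    Thm Ax (eq A D) :=
  replace h' h (.eqR _ .here)

theorem eq_mp {P Q : Form C} (h : Thm Ax (eq P Q)) (hP : Thm Ax P) : Thm Ax Q :=
  replace h hP .here

theorem app_congr {F G : Term C (Ty.fn α β)} {A B : Term C α} (h : Thm Ax (eq F G))
    (h' : Thm Ax (eq A B)) : Thm Ax (eq (app F A) (app G B)) :=
  replace h' (replace h (refl (app F A)) (.eqR _ (.appL _ .here))) (.eqR _ (.appR _ .here))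

theorem lam_congr (i : ℕ) (α : Ty n) {A B : Term C β} (h : Thm Ax (eq A B)) :
    Thm Ax (eq (lam i α A) (lam i α B)) :=
  replace h (refl (lam i α A)) (.eqR _ (.lam _ _ .here))

theorem eq_congr {A B A' B' : Term C α} (h : Thm Ax (eq A A')) (h' : Thm Ax (eq B B')) :
    Thm Ax (eq (eq A B) (eq A' B')) :=
  replace h' (replace h (refl (eq A B)) (.eqR _ (.eqL _ .here))) (.eqR _ (.eqR _ .here))

theorem all_congr (i : ℕ) (α : Ty n) {P Q : Form C} (h : Thm Ax (eq P Q)) :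
    Thm Ax (eq (all i α P) (all i α Q)) :=
  eq_congr (refl _) (lam_congr i α h)

theorem neg_congr {P Q : Form C} (h : Thm Ax (eq P Q)) : Thm Ax (eq (neg P) (neg Q)) :=
  eq_congr (refl _) h

theorem conj_congr {P Q P' Q' : Form C} (h : Thm Ax (eq P P')) (h' : Thm Ax (eq Q Q')) :
    Thm Ax (eq (conj P Q) (conj P' Q')) :=
  app_congr (app_congr (refl _) h) h'

theorem imp_congr {P Q P' Q' : Form C} (h : Thm Ax (eq P P')) (h' : Thm Ax (eq Q Q')) :
    Thm Ax (eq (imp P Q) (imp P' Q')) :=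
  eq_congr h (conj_congr h h')

theorem beta_var_self (i : ℕ) (A : Term C β) : Thm Ax (eq (app (lam i α A) (var i α)) A) := by
  simpa only [subst_var_self] using beta (Ax := Ax) i A (var i α) (freeFor_var_self i α A)

theorem beta_tru (i : ℕ) (A : Term C α) : Thm Ax (eq (app (lam i α tru) A) tru) := by
  simpa only [subst_tru] using beta (Ax := Ax) i tru A (freeFor_tru i A)

end Equality

section TruthValues

theorem tru_intro : Thm Ax (tru : Form C) := refl _

theorem tru_eq_subst {i : ℕ} {P : Form C} {A : Term C α} (h : Thm Ax (all i α P))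
    (hA : FreeFor i A P) : Thm Ax (eq tru (subst i A P)) :=
  ((beta_tru i A).symm.trans (app_congr h (refl A))).trans (beta i P A hA)

theorem inst {i : ℕ} {P : Form C} {A : Term C α} (h : Thm Ax (all i α P))
    (hA : FreeFor i A P) : Thm Ax (subst i A P) :=
  (tru_eq_subst h hA).eq_mp tru_intro

theorem inst_three {P : Form C} (h : Thm Ax (all 0 α (all 1 α (all 2 α P)))) {A B D : Term C α}
    (hA : Closed A) (hB : Closed B) (hD : Closed D) :
    Thm Ax (subst 2 D (subst 1 B (subst 0 A P))) := by
  have at_A := inst h hA.freeFor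
  simp only [all, Term.subst, subst_tru, one_ne_zero, OfNat.ofNat_ne_zero, false_and,
    if_false] at at_A
  have at_B := inst at_A hB.freeFor
  simp only [Term.subst, subst_tru, OfNat.ofNat_ne_one, false_and, if_false] at at_B
  exact inst at_B hD.freeFor

theorem tru_eq_refl (A : Term C α) : Thm Ax (eq tru (eq A A)) := by
  let I : Term C (Ty.fn α α) := lam 0 α (var 0 α)
  have not_free_I : ¬ Free 0 α I := fun h => h.1 ⟨rfl, rfl⟩
  have pointwise : Thm Ax (all 0 α (eq (app I (var 0 α)) (app I (var 0 α)))) :=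
    (extensionality 0 I I not_free_I not_free_I).eq_mp (refl I)
  have at_A : Thm Ax (eq tru (eq (app I A) (app I A))) := by
    simpa [I, Term.subst] using tru_eq_subst (A := A) pointwise (by simp [I, FreeFor])
  exact at_A.trans (eq_congr (beta_var 0 A) (beta_var 0 A))

theorem tru_eq_eq {A B : Term C α} (h : Thm Ax (eq A B)) : Thm Ax (eq tru (eq A B)) :=
  (tru_eq_refl A).trans (eq_congr (refl A) h)

theorem conj_subst_eq_all (i : ℕ) (P : Form C) :
    Thm Ax (eq (conj (subst i tru P) (subst i fls P)) (all i Ty.t P)) :=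
  ((conj_congr (beta i P tru closed_tru.freeFor) (beta i P fls closed_fls.freeFor)).symm.trans
    (truthValues i (lam i Ty.t P) (by simp [Free]))).trans (all_congr i Ty.t (beta_var_self i P))

theorem tru_conj_tru : Thm Ax (eq (conj tru tru) (tru : Form C)) := by
  have h := conj_subst_eq_all (Ax := Ax) 0 tru
  rw [subst_tru, subst_tru] at h
  exact h.trans (tru_eq_refl _).symm

theorem tru_conj_fls : Thm Ax (eq (conj tru fls) (fls : Form C)) := by
  have h := conj_subst_eq_all (Ax := Ax) 0 (var 0 Ty.t)
  rwa [subst_var_same, subst_var_same] at h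

theorem conj_of_tru_eq {P Q : Form C} (hP : Thm Ax (eq tru P)) (hQ : Thm Ax (eq tru Q)) :
    Thm Ax (conj P Q) :=
  (conj_congr hP hQ).eq_mp (tru_conj_tru.symm.eq_mp tru_intro)

theorem cases_of_tru_eq {i : ℕ} {P Q : Form C} (hT : Thm Ax (eq tru (subst i tru P)))
    (hF : Thm Ax (eq tru (subst i fls P))) (hQ : FreeFor i Q P) : Thm Ax (subst i Q P) :=
  inst ((conj_subst_eq_all i P).eq_mp (conj_of_tru_eq hT hF)) hQ

theorem tru_conj (P : Form C) : Thm Ax (eq (conj tru P) P) := by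
  simpa [Term.subst] using cases_of_tru_eq (Ax := Ax) (i := 0) (Q := P)
    (P := eq (conj tru (var 0 Ty.t)) (var 0 Ty.t))
    (by simpa [Term.subst] using tru_eq_eq tru_conj_tru)
    (by simpa [Term.subst] using tru_eq_eq tru_conj_fls) (by simp [FreeFor])

theorem tru_eq_fls : Thm Ax (eq (eq tru fls) (fls : Form C)) := by
  have fls_eq_all : Thm Ax (eq fls (all 0 Ty.t (eq tru (var 0 Ty.t)))) :=
    (extensionality 0 (lam 0 Ty.t tru) (lam 0 Ty.t (var 0 Ty.t)) (by simp [Free])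
      (by simp [Free])).trans (all_congr 0 Ty.t (eq_congr (beta_tru 0 _) (beta_var 0 _)))
  have conj_eq_all :
      Thm Ax (eq (conj (eq tru tru) (eq tru fls)) (all 0 Ty.t (eq tru (var 0 Ty.t)))) := by
    simpa [Term.subst] using conj_subst_eq_all (Ax := Ax) 0 (eq tru (var 0 Ty.t))
  exact (tru_conj _).symm.trans ((conj_congr (tru_eq_refl tru) (refl _)).trans
    (conj_eq_all.trans fls_eq_all.symm))

theorem tru_eq (P : Form C) : Thm Ax (eq (eq tru P) P) := by
  simpa [Term.subst] using cases_of_tru_eq (Ax := Ax) (i := 0) (Q := P)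
    (P := eq (eq tru (var 0 Ty.t)) (var 0 Ty.t))
    (by simpa [Term.subst] using tru_eq_eq (tru_eq_refl tru).symm)
    (by simpa [Term.subst] using tru_eq_eq tru_eq_fls) (by simp [FreeFor])

theorem tru_eq_of {P : Form C} (h : Thm Ax P) : Thm Ax (eq tru P) := (tru_eq P).symm.eq_mp h

theorem gen (i : ℕ) (α : Ty n) {P : Form C} (h : Thm Ax P) : Thm Ax (all i α P) :=
  lam_congr i α h.tru_eq_of

theorem subst {i : ℕ} {P : Form C} {A : Term C α} (h : Thm Ax P) (hA : FreeFor i A P) :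
    Thm Ax (subst i A P) :=
  inst (gen i α h) hA

theorem mp {P Q : Form C} (h : Thm Ax (imp P Q)) (hP : Thm Ax P) : Thm Ax Q :=
  ((conj_congr hP.tru_eq_of.symm (refl Q)).trans (tru_conj Q)).eq_mp (eq_mp h hP)

theorem cases {i : ℕ} {P Q : Form C} (hT : Thm Ax (Term.subst i tru P))
    (hF : Thm Ax (Term.subst i fls P)) (hQ : FreeFor i Q P) : Thm Ax (Term.subst i Q P) :=
  cases_of_tru_eq hT.tru_eq_of hF.tru_eq_of hQ

theorem eq_app_imp (F : Term C (Ty.fn α β)) (A B : Term C α) :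
    Thm Ax (imp (eq A B) (eq (app F A) (app F B))) := by
  let m := max (varBound F) (varBound A)
  have hF : ¬ Free m α F := not_free_of_varBound_le (le_max_left _ _)
  have hA : ¬ Free m α A := not_free_of_varBound_le (le_max_right _ _)
  let H : Term C (Ty.fn α Ty.t) := lam m α (eq (app F A) (app F (var m α)))
  have app_H (D : Term C α) : Thm Ax (eq (app H D) (eq (app F A) (app F D))) := by
    simpa [Term.subst, subst_of_not_free hF, subst_of_not_free hA] using
      beta (Ax := Ax) m (eq (app F A) (app F (var m α))) D
        ⟨⟨freeFor_of_not_free hF, freeFor_of_not_free hA⟩, freeFor_of_not_free hF, trivial⟩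
  have app_H_eq : Thm Ax (eq (eq (app H A) (app H B)) (eq (app F A) (app F B))) :=
    (eq_congr ((app_H A).trans (tru_eq_refl _).symm) (app_H B)).trans (tru_eq _)
  exact (imp_congr (refl _) app_H_eq).eq_mp (leibniz A B H)

theorem eq_subst_imp (i : ℕ) {S : Term C β} {A B : Term C α} (hA : FreeFor i A S)
    (hB : FreeFor i B S) :
    Thm Ax (imp (eq A B) (eq (Term.subst i A S) (Term.subst i B S))) :=
  (imp_congr (refl _) (eq_congr (beta i S A hA) (beta i S B hB))).eq_mp
    (eq_app_imp (lam i α S) A B)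

theorem fls_conj (P : Form C) : Thm Ax (eq (conj fls P) fls) := by
  -- `⊥` is the equation `λ x. ⊤ = λ x. x`, and applying both sides to `P` gives `⊤ = P`.
  let m := varBound P
  have hP : ¬ Free m (Ty.fn Ty.t Ty.t) P := not_free_of_varBound_le le_rfl
  have app_imp := eq_subst_imp (Ax := Ax) m (A := lam 0 Ty.t tru) (B := lam 0 Ty.t (var 0 Ty.t))
    (S := app (var m (Ty.fn Ty.t Ty.t)) P) ⟨trivial, freeFor_of_not_free hP⟩
    ⟨trivial, freeFor_of_not_free hP⟩
  simp only [Term.subst, subst_of_not_free hP, and_self, dite_true] at app_imp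
  have app_eq : Thm Ax (eq (eq (app (lam 0 Ty.t tru) P) (app (lam 0 Ty.t (var 0 Ty.t)) P)) P) :=
    (eq_congr (beta_tru 0 P) (beta_var 0 P)).trans (tru_eq P)
  exact (app_imp.trans (conj_congr (refl _) app_eq)).symm

theorem fls_eq_tru : Thm Ax (eq (eq fls tru) (fls : Form C)) := by
  have eq_fls_imp := eq_subst_imp (Ax := Ax) 0 (S := eq (var 0 Ty.t) fls) (A := fls) (B := tru)
    (by simp [FreeFor]) (by simp [FreeFor])
  simp only [Term.subst, subst_fls, and_self, dite_true] at eq_fls_imp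
  have rhs_eq_fls : Thm Ax (eq (eq (eq fls fls) (eq tru fls)) (fls : Form C)) :=
    (eq_congr (tru_eq_refl fls).symm tru_eq_fls).trans tru_eq_fls
  have conj_fls : Thm Ax (eq (conj (eq fls tru) fls) (fls : Form C)) := by
    simpa [Term.subst] using cases (i := 0) (P := eq (conj (var 0 Ty.t) fls) fls)
      (Q := eq fls tru) (by simpa [Term.subst] using tru_conj_fls)
      (by simpa [Term.subst] using fls_conj fls) (by simp [FreeFor])
  exact (eq_fls_imp.trans (conj_congr (refl _) rhs_eq_fls)).trans conj_fls

end TruthValues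

end Thm

/-- Propositional schemes over the atoms `ι`, with truth tables (`eval`) and with their instances
as formulas (`toForm`). -/
inductive PropForm (ι : Type*) where
  | var (i : ι)
  | fls
  | conj (p q : PropForm ι)
  | iff (p q : PropForm ι)

namespace PropForm

variable {ι : Type*}

/-- Negation, encoded as `Term.neg`. -/
abbrev neg (p : PropForm ι) : PropForm ι := iff fls p

/-- Disjunction, encoded as `Term.disj`. -/
abbrev disj (p q : PropForm ι) : PropForm ι := neg (conj (neg p) (neg q))

/-- Implication, encoded as `Term.imp`. -/
abbrev imp (p q : PropForm ι) : PropForm ι := iff p (conj p q)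

/-- The truth value of a propositional scheme under an assignment. -/
def eval (v : ι → Bool) : PropForm ι → Bool
  | var i => v i
  | fls => false
  | conj p q => eval v p && eval v q
  | iff p q => eval v p == eval v q

variable {n : ℕ} {C : Ty n → Type u}

/-- The instance of a propositional scheme with formulas for its atoms. -/
def toForm (σ : ι → Form C) : PropForm ι → Form C
  | var i => σ i
  | fls => Term.fls
  | conj p q => Term.conj (toForm σ p) (toForm σ q)
  | iff p q => Term.eq (toForm σ p) (toForm σ q)

/-- The formula `⊤` or `⊥` that denotes a truth value. -/
def boolForm (b : Bool) : Form C := bif b then Term.tru else Term.fls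

variable {σ : ι → Form C} {i : ℕ} {α : Ty n} {B : Term C α}

theorem subst_toForm (p : PropForm ι) :
    Term.subst i B (p.toForm σ) = p.toForm fun a => Term.subst i B (σ a) := by
  induction p with
  | var a => rfl
  | fls => exact subst_fls i B
  | conj p q ihp ihq => simp only [toForm, subst_conj, ihp, ihq]
  | iff p q ihp ihq => simp only [toForm, Term.subst, ihp, ihq]

theorem freeFor_toForm (h : ∀ a, FreeFor i B (σ a)) (p : PropForm ι) :
    FreeFor i B (p.toForm σ) := by
  induction p with
  | var a => exact h a
  | fls => exact freeFor_fls i B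
  | conj p q ihp ihq => exact (freeFor_conj i B _ _).2 ⟨ihp, ihq⟩
  | iff p q ihp ihq => exact ⟨ihp, ihq⟩

end PropForm

namespace Thm

open PropForm

variable {n : ℕ} {C : Ty n → Type u} {Ax : Set (Form C)}

theorem toForm_eq_boolForm {ι : Type*} (v : ι → Bool) (p : PropForm ι) :
    Thm Ax (eq (p.toForm fun i => boolForm (v i)) (boolForm (p.eval v))) := by
  induction p with
  | var i => exact refl _
  | fls => exact refl _
  | conj p q ihp ihq =>
    refine (conj_congr ihp ihq).trans ?_
    cases hp : p.eval v <;> simp only [eval, hp, boolForm, Bool.false_and, Bool.true_and]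
    exacts [fls_conj _, tru_conj _]
  | iff p q ihp ihq =>
    refine (eq_congr ihp ihq).trans ?_
    cases hp : p.eval v <;> cases hq : q.eval v <;> simp only [eval, hp, hq]
    exacts [(tru_eq_refl fls).symm, fls_eq_tru, tru_eq fls, tru_eq tru]

theorem of_update {ι : Type*} [Finite ι] [DecidableEq ι] {p : PropForm ι} {σ : ι → Form C} (a : ι)
    (h : ∀ b, Thm Ax (p.toForm (Function.update σ a (boolForm b)))) : Thm Ax (p.toForm σ) := by
  obtain ⟨m, hm⟩ := exists_varBound_le (Set.finite_range σ)
  have not_free (j : ι) : ¬ Free m Ty.t (σ j) := not_free_of_varBound_le (hm _ ⟨j, rfl⟩)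
  let τ := Function.update σ a (var m Ty.t)
  have subst_τ (Q : Form C) :
      Term.subst m Q (p.toForm τ) = p.toForm (Function.update σ a Q) := by
    rw [subst_toForm]
    congr 1
    funext j
    by_cases hj : j = a
    · subst hj; simp [τ]
    · simp [τ, hj, subst_of_not_free (not_free j)]
  have freeFor_τ : FreeFor m (σ a) (p.toForm τ) := by
    refine freeFor_toForm (fun j => ?_) p
    by_cases hj : j = a
    · subst hj; simp [τ, FreeFor]
    · simpa [τ, hj] using freeFor_of_not_free (not_free j)
  have h_cases := cases (i := m) (subst_τ tru ▸ h true) (subst_τ fls ▸ h false) freeFor_τ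
  rwa [subst_τ, Function.update_eq_self] at h_cases

theorem taut {ι : Type*} [Finite ι] (p : PropForm ι) (h : ∀ v, p.eval v = true) (σ : ι → Form C) :
    Thm Ax (p.toForm σ) := by
  classical
  have := Fintype.ofFinite ι
  suffices ∀ (s : Finset ι) (σ : ι → Form C), (∀ i ∉ s, ∃ b, σ i = boolForm b) →
      Thm Ax (p.toForm σ) from this Finset.univ σ (by simp)
  intro s
  induction s using Finset.induction with
  | empty =>
    intro σ hσ
    choose v hv using fun i => hσ i (Finset.notMem_empty i)
    have eq_tru := toForm_eq_boolForm (Ax := Ax) v p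
    rw [h v, ← funext hv] at eq_tru
    exact eq_tru.symm.eq_mp tru_intro
  | insert a s _ ih =>
    intro σ hσ
    refine of_update a fun b => ih _ fun i hi => ?_
    by_cases hia : i = a
    · subst hia; exact ⟨b, by simp⟩
    · simpa [hia] using hσ i (by simp [hia, hi])

section PropositionalRules

variable {P Q R : Form C}

theorem imp_self (P : Form C) : Thm Ax (imp P P) :=
  taut (.imp (.var 0) (.var 0)) (by decide) ![P]

theorem fls_imp (P : Form C) : Thm Ax (imp fls P) :=
  taut (.imp .fls (.var 0)) (by decide) ![P]

theorem imp_disj_left (P Q : Form C) : Thm Ax (imp P (disj P Q)) :=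
  taut (.imp (.var 0) (.disj (.var 0) (.var 1))) (by decide) ![P, Q]

theorem imp_disj_right (P Q : Form C) : Thm Ax (imp Q (disj P Q)) :=
  taut (.imp (.var 1) (.disj (.var 0) (.var 1))) (by decide) ![P, Q]

theorem imp_of (P : Form C) (h : Thm Ax Q) : Thm Ax (imp P Q) :=
  mp (taut (.imp (.var 1) (.imp (.var 0) (.var 1))) (by decide) ![P, Q]) h

theorem imp_of_neg (Q : Form C) (h : Thm Ax (neg P)) : Thm Ax (imp P Q) :=
  mp (taut (.imp (.neg (.var 0)) (.imp (.var 0) (.var 1))) (by decide) ![P, Q]) h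

theorem disj_of_neg_imp (h : Thm Ax (imp (neg P) Q)) : Thm Ax (disj P Q) :=
  mp (taut (.imp (.imp (.neg (.var 0)) (.var 1)) (.disj (.var 0) (.var 1))) (by decide) ![P, Q]) h

theorem imp_trans (h : Thm Ax (imp P Q)) (h' : Thm Ax (imp Q R)) : Thm Ax (imp P R) :=
  mp (mp (taut (.imp (.imp (.var 0) (.var 1)) (.imp (.imp (.var 1) (.var 2))
    (.imp (.var 0) (.var 2)))) (by decide) ![P, Q, R]) h) h'

theorem modus_tollens (h : Thm Ax (imp P Q)) (hQ : Thm Ax (neg Q)) : Thm Ax (neg P) :=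
  mp (mp (taut (.imp (.imp (.var 0) (.var 1)) (.imp (.neg (.var 1)) (.neg (.var 0)))) (by decide)
    ![P, Q]) h) hQ

theorem disj_imp (h : Thm Ax (imp P R)) (h' : Thm Ax (imp Q R)) :
    Thm Ax (imp (disj P Q) R) :=
  mp (mp (taut (.imp (.imp (.var 0) (.var 2)) (.imp (.imp (.var 1) (.var 2))
    (.imp (.disj (.var 0) (.var 1)) (.var 2)))) (by decide) ![P, Q, R]) h) h'

theorem imp_of_imp_eq (h : Thm Ax (imp P (eq Q R))) (hQ : Thm Ax Q) : Thm Ax (imp P R) :=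
  mp (mp (taut (.imp (.imp (.var 0) (.iff (.var 1) (.var 2))) (.imp (.var 1)
    (.imp (.var 0) (.var 2)))) (by decide) ![P, Q, R]) h) hQ

theorem foldr_imp_mp (l : List (Form C)) (P Q : Form C) :
    Thm Ax (imp (l.foldr imp P) (imp (imp P Q) (l.foldr imp Q))) := by
  induction l with
  | nil =>
    exact taut (.imp (.var 0) (.imp (.imp (.var 0) (.var 1)) (.var 1))) (by decide) ![P, Q]
  | cons D l ih =>
    exact mp (taut (.imp (.imp (.var 1) (.imp (.var 2) (.var 3)))
      (.imp (.imp (.var 0) (.var 1)) (.imp (.var 2) (.imp (.var 0) (.var 3))))) (by decide)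
      ![D, l.foldr imp P, imp P Q, l.foldr imp Q]) ih

theorem of_foldr_imp {l : List (Form C)} (h : Thm Ax (l.foldr imp P)) (hl : ∀ Q ∈ l, Thm Ax Q) :
    Thm Ax P := by
  induction l with
  | nil => exact h
  | cons Q l ih =>
    exact ih (h.mp (hl Q List.mem_cons_self)) fun R hR => hl R (List.mem_cons_of_mem Q hR)

end PropositionalRules

section EqualityRules

variable {α β : Ty n} {A B : Term C α}

theorem eq_symm_imp (A B : Term C α) : Thm Ax (imp (eq A B) (eq B A)) := by
  have hA : ¬ Free (varBound A) α A := not_free_of_varBound_le le_rfl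
  have h := eq_subst_imp (Ax := Ax) (varBound A) (A := A) (B := B) (S := eq (var (varBound A) α) A)
    ⟨trivial, freeFor_of_not_free hA⟩ ⟨trivial, freeFor_of_not_free hA⟩
  simp only [Term.subst, subst_of_not_free hA, and_self, dite_true] at h
  exact imp_of_imp_eq h (refl A)

theorem neg_eq_symm (h : Thm Ax (neg (eq A B))) : Thm Ax (neg (eq B A)) :=
  modus_tollens (eq_symm_imp B A) h

theorem pair_eq_imp_fst (A A' : Term C α) (B B' : Term C β) :
    Thm Ax (imp (eq (pair A B) (pair A' B')) (eq A A')) := by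
  have h := eq_subst_imp (Ax := Ax) 0 (A := pair A B) (B := pair A' B')
    (S := fst (var 0 (Ty.prod α β))) trivial trivial
  simp only [Term.subst, and_self, dite_true] at h
  exact (imp_congr (refl _) (eq_congr (fstPair A B) (fstPair A' B'))).eq_mp h

theorem pair_eq_imp_snd (A A' : Term C α) (B B' : Term C β) :
    Thm Ax (imp (eq (pair A B) (pair A' B')) (eq B B')) := by
  have h := eq_subst_imp (Ax := Ax) 0 (A := pair A B) (B := pair A' B')
    (S := snd (var 0 (Ty.prod α β))) trivial trivial
  simp only [Term.subst, and_self, dite_true] at h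
  exact (imp_congr (refl _) (eq_congr (sndPair A B) (sndPair A' B'))).eq_mp h

end EqualityRules

end Thm

namespace Derives

variable {n : ℕ} {C : Ty n → Type u} {Ax Δ : Set (Form C)} {P Q : Form C}

theorem of_thm (h : Thm Ax P) : Derives Ax Δ P := ⟨[], by simp, h⟩

theorem of_mem (h : P ∈ Δ) : Derives Ax Δ P := ⟨[P], by simpa using h, .imp_self P⟩

theorem mp (h : Derives Ax Δ (imp P Q)) (hP : Derives Ax Δ P) : Derives Ax Δ Q := by
  obtain ⟨l, hl, h⟩ := h
  obtain ⟨l', hl', hP⟩ := hP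
  refine ⟨l ++ l', fun R hR => (List.mem_append.1 hR).elim (hl R) (hl' R), ?_⟩
  rw [List.foldr_append]
  exact ((Thm.foldr_imp_mp l (imp P Q) _).mp h).mp ((Thm.foldr_imp_mp l' P Q).mp hP)

theorem app_of_disj {α : Ty n} {H : Term C (Ty.fn α Ty.t)} {A B D : Term C α}
    (h : Thm Ax (disj (eq A B) (eq A D))) (hB : Derives Ax Δ (app H B))
    (hD : Derives Ax Δ (app H D)) : Derives Ax Δ (app H A) := by
  have leibniz_cases := (((Thm.taut (Ax := Ax)
    (.imp (.disj (.var 0) (.var 1))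
      (.imp (.imp (.var 0) (.iff (.var 2) (.var 3))) (.imp (.imp (.var 1) (.iff (.var 2) (.var 4)))
        (.imp (.var 3) (.imp (.var 4) (.var 2)))))) (by decide)
    ![eq A B, eq A D, app H A, app H B, app H D]).mp h).mp (.leibniz A B H)).mp (.leibniz A D H)
  exact ((of_thm leibniz_cases).mp hB).mp hD

end Derives

namespace Term

variable {n : ℕ} {C : Ty n → Type u} {α : Ty n}

/-- The term `if P then X else Y`, as the description of the `z` such that `P ∧ X = z` or
`¬ P ∧ Y = z`. The bound variable `z` is `var i α`, which must not be free in `P`, `X`, `Y`. -/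
def ifThenElse (i : ℕ) (P : Form C) (X Y : Term C α) : Term C α :=
  app (iota α) (lam i α (disj (conj P (eq X (var i α))) (conj (neg P) (eq Y (var i α)))))

/-- The formula `A = B₁ ∨ ⋯ ∨ A = Bₖ`, for the members `B₁, …, Bₖ` of `l`. -/
def oneOf (A : Term C α) (l : List (Term C α)) : Form C :=
  l.foldr (fun B Q => disj (eq A B) Q) fls

theorem subst_oneOf {i : ℕ} {β : Ty n} {B : Term C β} {A : Term C α} {l : List (Term C α)}
    (hl : ∀ D ∈ l, ¬ Free i β D) : subst i B (oneOf A l) = oneOf (subst i B A) l := by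
  induction l with
  | nil => exact subst_fls i B
  | cons D l ih =>
    rw [List.forall_mem_cons] at hl
    exact (subst_disj i B _ _).trans
      (congrArg₂ disj (congrArg (eq _) (subst_of_not_free hl.1)) (ih hl.2))

theorem freeFor_oneOf {i : ℕ} {β : Ty n} {B : Term C β} {A : Term C α} {l : List (Term C α)}
    (hA : FreeFor i B A) (hl : ∀ D ∈ l, ¬ Free i β D) : FreeFor i B (oneOf A l) := by
  induction l with
  | nil => exact freeFor_fls i B
  | cons D l ih =>
    rw [List.forall_mem_cons] at hl
    exact (freeFor_disj i B _ _).2 ⟨⟨hA, freeFor_of_not_free hl.1⟩, ih hl.2⟩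

end Term

namespace Thm

variable {n : ℕ} {C : Ty n → Type u} {Ax : Set (Form C)} {α : Ty n}

theorem imp_subst_of_tru {i : ℕ} {P Q : Form C} (h : Thm Ax (Term.subst i tru Q))
    (hP : FreeFor i P Q) : Thm Ax (imp P (Term.subst i P Q)) := by
  have h_cases := cases (i := i) (P := imp (var i Ty.t) Q) (Q := P)
    (by simpa only [subst_imp] using imp_of _ h)
    (by simpa only [subst_imp, subst_var_same] using fls_imp _) (by simp [FreeFor, hP])
  rwa [subst_imp, subst_var_same] at h_cases

theorem neg_imp_subst_of_fls {i : ℕ} {P Q : Form C} (h : Thm Ax (Term.subst i fls Q))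
    (hP : FreeFor i P Q) : Thm Ax (imp (neg P) (Term.subst i P Q)) := by
  have neg_neg_tru : Thm Ax (neg (neg (tru : Form C))) :=
    mp (taut (.imp (.var 0) (.neg (.neg (.var 0)))) (by decide) ![tru]) tru_intro
  have h_cases := cases (i := i) (P := imp (neg (var i Ty.t)) Q) (Q := P)
    (by simpa only [subst_imp, subst_neg, subst_var_same] using imp_of_neg _ neg_neg_tru)
    (by simpa only [subst_imp] using imp_of _ h) (by simp [FreeFor, hP])
  rwa [subst_imp, subst_neg, subst_var_same] at h_cases

section Conditional

variable {i : ℕ} {X Y : Term C α}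

theorem ifThenElse_tru (hX : ¬ Free i α X) : Thm Ax (eq (ifThenElse i tru X Y) X) :=
  (app_congr (refl _) (lam_congr i α (mp (taut (.imp (.var 0)
    (.iff (.disj (.conj (.var 0) (.var 1)) (.conj (.neg (.var 0)) (.var 2))) (.var 1)))
    (by decide) ![tru, eq X (var i α), eq Y (var i α)]) tru_intro))).trans (description i X hX)

theorem ifThenElse_fls (hY : ¬ Free i α Y) : Thm Ax (eq (ifThenElse i fls X Y) Y) :=
  (app_congr (refl _) (lam_congr i α (taut
    (.iff (.disj (.conj .fls (.var 0)) (.conj (.neg .fls) (.var 1))) (.var 1)) (by decide)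
    ![eq X (var i α), eq Y (var i α)]))).trans (description i Y hY)

theorem exists_ifThenElse (P : Form C) (X Y : Term C α) :
    ∃ Z, Thm Ax (imp P (eq Z X)) ∧ Thm Ax (imp (neg P) (eq Z Y)) := by
  let i := max (varBound P) (max (varBound X) (varBound Y))
  have hP : ¬ Free i α P := not_free_of_varBound_le (by omega)
  have hX {j : ℕ} (hj : i ≤ j) (β : Ty n) : ¬ Free j β X := not_free_of_varBound_le (by omega)
  have hY {j : ℕ} (hj : i ≤ j) (β : Ty n) : ¬ Free j β Y := not_free_of_varBound_le (by omega)
  let S := ifThenElse i (var (i + 1) Ty.t) X Y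
  have subst_X (Q : Form C) : Term.subst (i + 1) Q X = X := subst_of_not_free (hX i.le_succ _)
  have subst_Y (Q : Form C) : Term.subst (i + 1) Q Y = Y := subst_of_not_free (hY i.le_succ _)
  have freeFor_X : FreeFor (i + 1) P X := freeFor_of_not_free (hX i.le_succ _)
  have freeFor_Y : FreeFor (i + 1) P Y := freeFor_of_not_free (hY i.le_succ _)
  have subst_S (Q : Form C) : Term.subst (i + 1) Q S = ifThenElse i Q X Y := by
    simp [S, ifThenElse, Term.subst, subst_X, subst_Y]
  have freeFor_S : FreeFor (i + 1) P S := by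
    simp [S, ifThenElse, FreeFor, hP, freeFor_X, freeFor_Y]
  refine ⟨ifThenElse i P X Y, ?_, ?_⟩
  · simpa only [Term.subst, subst_S, subst_X] using imp_subst_of_tru (i := i + 1) (Q := eq S X)
      (by simpa only [Term.subst, subst_S, subst_X] using ifThenElse_tru (hX le_rfl α))
      ⟨freeFor_S, freeFor_X⟩
  · simpa only [Term.subst, subst_S, subst_Y] using neg_imp_subst_of_fls (i := i + 1) (Q := eq S Y)
      (by simpa only [Term.subst, subst_S, subst_Y] using ifThenElse_fls (hY le_rfl α))
      ⟨freeFor_S, freeFor_Y⟩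

end Conditional

section OneOf

variable {A B : Term C α} {l : List (Term C α)}

theorem eq_imp_oneOf (hB : B ∈ l) : Thm Ax (imp (eq A B) (oneOf A l)) := by
  induction l with
  | nil => simp at hB
  | cons D l ih =>
    rcases List.mem_cons.1 hB with rfl | hB
    · exact imp_disj_left _ _
    · exact imp_trans (ih hB) (imp_disj_right _ _)

theorem oneOf_of_mem (hA : A ∈ l) : Thm Ax (oneOf A l) := (eq_imp_oneOf hA).mp (refl A)

theorem oneOf_imp {Q : Form C} (h : ∀ B ∈ l, Thm Ax (imp (eq A B) Q)) :
    Thm Ax (imp (oneOf A l) Q) := by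
  induction l with
  | nil => exact fls_imp Q
  | cons D l ih =>
    rw [List.forall_mem_cons] at h
    exact disj_imp h.1 (ih h.2)

theorem eq_imp_oneOf_eq (A B : Term C α) (l : List (Term C α)) :
    Thm Ax (imp (eq A B) (eq (oneOf A l) (oneOf B l))) := by
  obtain ⟨m, hm⟩ := exists_varBound_le l.finite_toSet
  have not_free : ∀ D ∈ l, ¬ Free m α D := fun D hD => not_free_of_varBound_le (hm D hD)
  simpa only [subst_oneOf not_free, subst_var_same] using
    eq_subst_imp (Ax := Ax) m (A := A) (B := B) (S := oneOf (var m α) l)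
      (freeFor_oneOf trivial not_free) (freeFor_oneOf trivial not_free)

end OneOf

end Thm

/-- Sets of terms that contain each term provably equal to one or the other of two of its members.
The languages that are logically closed are those whose sections over all words have this
property. -/
def EqDisjClosed {n : ℕ} {C : Ty n → Type u} {α : Ty n} (Ax : Set (Form C))
    (S : Set (Term C α)) : Prop :=
  ∀ A B D : Term C α, B ∈ S → D ∈ S → Thm Ax (disj (eq A B) (eq A D)) → A ∈ S

namespace EqDisjClosed

variable {n : ℕ} {C : Ty n → Type u} {α : Ty n} {Ax : Set (Form C)} {S : Set (Term C α)}

theorem mem_of_disj_oneOf (hS : EqDisjClosed Ax S) {A B : Term C α} {l : List (Term C α)}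
    (hB : B ∈ S) (hl : ∀ D ∈ l, D ∈ S) (h : Thm Ax (disj (eq A B) (oneOf A l))) : A ∈ S := by
  induction l generalizing A B with
  | nil =>
    exact hS A B B hB hB ((Thm.taut (.imp (.disj (.var 0) .fls) (.disj (.var 0) (.var 0)))
      (by decide) ![eq A B]).mp h)
  | cons D l ih =>
    rw [List.forall_mem_cons] at hl
    -- For `Z := if A = B then D else A`, the term `Z` is one of `D, l`, and `A` is one of `B, Z`.
    obtain ⟨Z, Z_eq_D, Z_eq_A⟩ := Thm.exists_ifThenElse (Ax := Ax) (eq A B) D A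
    have oneOf_Z := Thm.taut (Ax := Ax)
      (.imp (.disj (.var 0) (.var 1)) (.imp (.imp (.var 0) (.var 2)) (.imp (.imp (.neg (.var 0))
        (.var 3)) (.imp (.imp (.var 3) (.iff (.disj (.var 2) (.var 4)) (.var 1)))
          (.disj (.var 2) (.var 4)))))) (by decide)
      ![eq A B, oneOf A (D :: l), eq Z D, eq Z A, oneOf Z l]
    have mem_Z : Z ∈ S := ih hl.1 hl.2 <|
      (((oneOf_Z.mp h).mp Z_eq_D).mp Z_eq_A).mp (Thm.eq_imp_oneOf_eq Z A (D :: l))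
    exact hS A B Z hB mem_Z (Thm.disj_of_neg_imp (Z_eq_A.imp_trans (Thm.eq_symm_imp Z A)))

theorem mem_of_oneOf (hS : EqDisjClosed Ax S) (hAx : ¬ Thm Ax fls) {A : Term C α}
    {l : List (Term C α)} (hl : ∀ D ∈ l, D ∈ S) (h : Thm Ax (oneOf A l)) : A ∈ S := by
  cases l with
  | nil => exact absurd h hAx
  | cons B l =>
    rw [List.forall_mem_cons] at hl
    exact hS.mem_of_disj_oneOf hl.1 hl.2 h

end EqDisjClosed

namespace Term

variable {n : ℕ} {C : Ty n → Type u} {D : Ty n → Type v}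

/-- Replacement of the non-logical constants by terms. Bound variables are not renamed, so it is
used only for terms whose free variables are fresh (`FreshAbove`). -/
def csubst (σ : ∀ α : Ty n, C α → Term D α) : {β : Ty n} → Term C β → Term D β
  | _, var i α => var i α
  | _, const c => σ _ c
  | _, iota α => iota α
  | _, app A B => app (csubst σ A) (csubst σ B)
  | _, lam i α A => lam i α (csubst σ A)
  | _, eq A B => eq (csubst σ A) (csubst σ B)
  | _, pair A B => pair (csubst σ A) (csubst σ B)
  | _, fst A => fst (csubst σ A)
  | _, snd A => snd (csubst σ A)

theorem csubst_const {β : Ty n} (A : Term C β) : csubst (fun _ c => const c) A = A := by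
  induction A <;> simp_all [csubst]

theorem csubst_map {C' : Ty n → Type*} (f : ∀ α : Ty n, C' α → C α)
    (σ : ∀ α : Ty n, C α → Term D α) {β : Ty n} (A : Term C' β) :
    csubst σ (map f A) = csubst (fun _ c => σ _ (f _ c)) A := by
  induction A <;> simp_all [csubst, map]

theorem map_eq_csubst (f : ∀ α : Ty n, C α → D α) {β : Ty n} (A : Term C β) :
    map f A = csubst (fun _ c => const (f _ c)) A := by
  induction A <;> simp_all [csubst, map]

theorem csubst_foldr_imp (σ : ∀ α : Ty n, C α → Term D α) (P : Form C) (l : List (Form C)) :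
    csubst σ (l.foldr imp P) = (l.map (csubst σ)).foldr imp (csubst σ P) := by
  induction l with
  | nil => rfl
  | cons Q l ih => exact congrArg (imp (csubst σ Q)) ih

theorem Replace.csubst (σ : ∀ α : Ty n, C α → Term D α) {α β : Ty n} {A B : Term C α}
    {P Q : Term C β} (h : Replace A B P Q) :
    Replace (A.csubst σ) (B.csubst σ) (P.csubst σ) (Q.csubst σ) := by
  induction h with
  | here => exact .here
  | appL _ _ ih => exact .appL _ ih
  | appR _ _ ih => exact .appR _ ih
  | lam _ _ _ ih => exact .lam _ _ ih
  | eqL _ _ ih => exact .eqL _ ih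
  | eqR _ _ ih => exact .eqR _ ih
  | pairL _ _ ih => exact .pairL _ ih
  | pairR _ _ ih => exact .pairR _ ih
  | fst _ ih => exact .fst ih
  | snd _ ih => exact .snd ih

/-- All free variables of the terms `σ α c` have an index of at least `M`, so that no abstraction
over a variable of smaller index captures them. -/
def FreshAbove (M : ℕ) (σ : ∀ α : Ty n, C α → Term D α) : Prop :=
  ∀ (α : Ty n) (c : C α) (i : ℕ) (γ : Ty n), Free i γ (σ α c) → M ≤ i

section FreshAbove

variable {M : ℕ} {σ : ∀ α : Ty n, C α → Term D α}

theorem FreshAbove.mono {M' : ℕ} (hσ : FreshAbove M σ) (h : M' ≤ M) : FreshAbove M' σ :=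
  fun α c i γ hf => h.trans (hσ α c i γ hf)

theorem FreshAbove.not_free (hσ : FreshAbove M σ) {i : ℕ} (hi : i < M) {α β : Ty n} (c : C β) :
    ¬ Free i α (σ β c) :=
  fun h => hi.not_ge (hσ β c i α h)

theorem free_csubst (hσ : FreshAbove M σ) {i : ℕ} (hi : i < M) {α β : Ty n} (A : Term C β) :
    Free i α (csubst σ A) ↔ Free i α A := by
  induction A with
  | const c => exact iff_of_false (hσ.not_free hi c) id
  | _ => simp_all [csubst, Free]

theorem csubst_subst (hσ : FreshAbove M σ) {i : ℕ} (hi : i < M) {α β : Ty n} (B : Term C α)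
    (A : Term C β) : csubst σ (subst i B A) = subst i (csubst σ B) (csubst σ A) := by
  induction A with
  | const c => exact (subst_of_not_free (hσ.not_free hi c)).symm
  | var j γ =>
    simp only [csubst, subst]
    split_ifs with h
    · obtain ⟨rfl, rfl⟩ := h; rfl
    · rfl
  | lam j γ A ih =>
    simp only [csubst, subst]
    split_ifs with h
    · rfl
    · simp only [csubst, ih]
  | _ => simp_all [csubst, subst]

theorem FreeFor.csubst (hσ : FreshAbove M σ) {i : ℕ} (hi : i < M) {α β : Ty n} {B : Term C α}
    {A : Term C β} (hA : varBound A ≤ M) (h : FreeFor i B A) :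
    FreeFor i (csubst σ B) (csubst σ A) := by
  induction A with
  | const c => exact freeFor_of_not_free (hσ.not_free hi c)
  | lam j γ A ih =>
    simp only [varBound, max_le_iff] at hA
    simp only [Term.csubst, FreeFor, free_csubst hσ hi, free_csubst hσ hA.1]
    exact h.imp_right (Or.imp_right (And.imp_right (ih hA.2)))
  | _ => simp_all [varBound, Term.csubst, FreeFor]

end FreshAbove

end Term

namespace Thm

variable {n : ℕ} {C : Ty n → Type u} {D : Ty n → Type v} {Ax : Set (Form C)} {P : Form C}

theorem csubst (h : Thm Ax P) :
    ∃ M : ℕ, ∀ (Ax' : Set (Form D)) (σ : ∀ α : Ty n, C α → Term D α), FreshAbove M σ →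
      (∀ Q ∈ Ax, Thm Ax' (Q.csubst σ)) → Thm Ax' (P.csubst σ) := by
  induction h with
  | nonlogical h => exact ⟨0, fun _ _ _ hAx => hAx _ h⟩
  | truthValues i G hG =>
    exact ⟨i + 1, fun _ _ hσ _ => .truthValues i _ (by rwa [free_csubst hσ i.lt_succ_self])⟩
  | leibniz A B H => exact ⟨0, fun _ _ _ _ => .leibniz _ _ _⟩
  | extensionality i F G hF hG =>
    exact ⟨i + 1, fun _ _ hσ _ => .extensionality i _ _
      (by rwa [free_csubst hσ i.lt_succ_self]) (by rwa [free_csubst hσ i.lt_succ_self])⟩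
  | beta i A B hB =>
    refine ⟨max (i + 1) (varBound A), fun _ σ hσ _ => ?_⟩
    have hi : i < max (i + 1) (varBound A) := lt_max_of_lt_left i.lt_succ_self
    simp only [Term.csubst]
    rw [csubst_subst hσ hi]
    exact .beta i _ _ (hB.csubst hσ hi (le_max_right _ _))
  | description i A hA =>
    exact ⟨i + 1, fun _ _ hσ _ => .description i _ (by rwa [free_csubst hσ i.lt_succ_self])⟩
  | fstPair A B => exact ⟨0, fun _ _ _ _ => .fstPair _ _⟩
  | sndPair A B => exact ⟨0, fun _ _ _ _ => .sndPair _ _⟩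
  | pairProj A => exact ⟨0, fun _ _ _ _ => .pairProj _⟩
  | replace _ _ hr ih ih' =>
    obtain ⟨M, hM⟩ := ih
    obtain ⟨M', hM'⟩ := ih'
    exact ⟨max M M', fun Ax' σ hσ hAx =>
      .replace (hM Ax' σ (hσ.mono (le_max_left _ _)) hAx)
        (hM' Ax' σ (hσ.mono (le_max_right _ _)) hAx) (hr.csubst σ)⟩

theorem map (h : Thm Ax P) (f : ∀ α : Ty n, C α → D α) : Thm (Term.map f '' Ax) (P.map f) := by
  obtain ⟨M, hM⟩ := h.csubst (D := D)
  rw [map_eq_csubst]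
  refine hM _ _ (fun _ _ _ _ => False.elim) fun Q hQ => ?_
  rw [← map_eq_csubst]
  exact .nonlogical ⟨Q, hQ, rfl⟩

end Thm

section NewConstant

variable {n : ℕ} {C : Ty n → Type u} (E : Ty n → Type v) {α β : Ty n}

/-- The constants of an extension by additional non-logical constants `E`. -/
abbrev SumConst (C : Ty n → Type u) (E : Ty n → Type v) : Ty n → Type (max u v) :=
  fun γ => C γ ⊕ E γ

/-- The inclusion of the terms into the terms of an extension. -/
def incl (A : Term C α) : Term (SumConst C E) α := A.map fun _ c => Sum.inl c

variable {E}

/-- The replacement of all additional constants by the variables of index `m`. -/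
def constToVar (m : ℕ) (A : Term (SumConst C E) α) : Term C α :=
  A.csubst fun γ => Sum.elim const fun _ => var m γ

theorem constToVar_incl (m : ℕ) (A : Term C α) : constToVar m (incl E A) = A :=
  (csubst_map _ _ A).trans (csubst_const A)

theorem Thm.constToVar_of_incl {Ax : Set (Form C)} {P : Form (SumConst C E)}
    (h : Thm (incl E '' Ax) P) : ∃ M, ∀ m ≥ M, Thm Ax (constToVar m P) := by
  obtain ⟨M, hM⟩ := h.csubst (D := C)
  refine ⟨M, fun m hm => hM Ax _ ?_ ?_⟩
  · rintro γ (c | e) i δ h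
    exacts [h.elim, h.1 ▸ hm]
  · rintro _ ⟨Q, hQ, rfl⟩
    exact (congrArg (Thm Ax) (constToVar_incl m Q)).mpr (.nonlogical hQ)

/-- The formula `c X A`, for an additional constant `c`. -/
def newConstForm (c : E (Ty.fn β (Ty.fn α Ty.t))) (X : Term C β) (A : Term C α) :
    Form (SumConst C E) :=
  app (app (const (Sum.inr c)) (incl E X)) (incl E A)

/-- The formulas `c X A` with `(X, A) ∈ S`, for an additional constant `c`. -/
def newConstAxioms (c : E (Ty.fn β (Ty.fn α Ty.t))) (S : Set (Term C β × Term C α)) :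
    Set (Form (SumConst C E)) :=
  {P | ∃ p ∈ S, newConstForm c p.1 p.2 = P}

/-- The term `λ x. λ y. (x, y) = D₁ ∨ ⋯ ∨ (x, y) = Dₖ`, for the members `D₁, …, Dₖ` of `l`. The
bound variables, of indices `m` and `m + 1`, must not be free in the members of `l`. -/
def listGraph (m : ℕ) (l : List (Term C (Ty.prod β α))) : Term C (Ty.fn β (Ty.fn α Ty.t)) :=
  lam m β (lam (m + 1) α (oneOf (pair (var m β) (var (m + 1) α)) l))

theorem Thm.listGraph_app {Ax : Set (Form C)} {m : ℕ} {l : List (Term C (Ty.prod β α))}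
    (hl : ∀ D ∈ l, varBound D ≤ m) {X : Term C β} (hX : varBound X ≤ m) (A : Term C α) :
    Thm Ax (eq (app (app (listGraph m l) X) A) (oneOf (pair X A) l)) := by
  have not_free_l {i : ℕ} (hi : m ≤ i) (γ : Ty n) : ∀ D ∈ l, ¬ Free i γ D :=
    fun D hD => not_free_of_varBound_le ((hl D hD).trans hi)
  have not_free_X : ¬ Free (m + 1) α X := not_free_of_varBound_le (hX.trans m.le_succ)
  have freeFor_X : FreeFor m X (lam (m + 1) α (oneOf (pair (var m β) (var (m + 1) α)) l)) :=
    .inr (.inr ⟨not_free_X, freeFor_oneOf (by simp [FreeFor]) (not_free_l le_rfl β)⟩)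
  have freeFor_A : FreeFor (m + 1) A (oneOf (pair X (var (m + 1) α)) l) :=
    freeFor_oneOf (by simp [FreeFor, freeFor_of_not_free not_free_X]) (not_free_l m.le_succ α)
  have beta_X := Thm.beta (Ax := Ax) m _ X freeFor_X
  have beta_A := Thm.beta (Ax := Ax) (m + 1) _ A freeFor_A
  simp only [Term.subst, subst_oneOf (not_free_l le_rfl β), Nat.succ_ne_self, false_and, if_false,
    dite_false] at beta_X
  rw [subst_oneOf (not_free_l m.le_succ α)] at beta_A
  simp only [Term.subst, subst_of_not_free not_free_X, and_self, dite_true] at beta_A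
  exact (Thm.app_congr beta_X (.refl A)).trans beta_A

variable {Ax : Set (Form C)} {c : E (Ty.fn β (Ty.fn α Ty.t))} {S : Set (Term C β × Term C α)}

theorem constToVar_newConstForm (m : ℕ) (X : Term C β) (A : Term C α) :
    constToVar m (newConstForm c X A) = app (app (var m _) X) A :=
  congrArg₂ app (congrArg₂ app rfl (constToVar_incl m X)) (constToVar_incl m A)

theorem subst_constToVar_newConstForm {m : ℕ} (G : Term C (Ty.fn β (Ty.fn α Ty.t))) {X : Term C β}
    {A : Term C α} (h : varBound (pair X A) ≤ m) :
    subst m G (constToVar m (newConstForm c X A)) = app (app G X) A := by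
  have hX : ¬ Free m (Ty.fn β (Ty.fn α Ty.t)) X :=
    not_free_of_varBound_le ((le_max_left _ _).trans h)
  have hA : ¬ Free m (Ty.fn β (Ty.fn α Ty.t)) A :=
    not_free_of_varBound_le ((le_max_right _ _).trans h)
  simp [constToVar_newConstForm, subst, subst_of_not_free hX, subst_of_not_free hA]

theorem freeFor_constToVar_newConstForm {m : ℕ} (G : Term C (Ty.fn β (Ty.fn α Ty.t)))
    {X : Term C β} {A : Term C α} (h : varBound (pair X A) ≤ m) :
    FreeFor m G (constToVar m (newConstForm c X A)) := by
  rw [constToVar_newConstForm]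
  exact ⟨⟨trivial, freeFor_of_not_free (not_free_of_varBound_le ((le_max_left _ _).trans h))⟩,
    freeFor_of_not_free (not_free_of_varBound_le ((le_max_right _ _).trans h))⟩

theorem Derives.exists_replace_newConst {P : Form (SumConst C E)}
    (h : Derives (incl E '' Ax) (newConstAxioms c S) P) :
    ∃ l : List (Term C β × Term C α), (∀ p ∈ l, p ∈ S) ∧ ∃ M, ∀ m ≥ M, ∀ G,
      (∀ p ∈ l, Thm Ax (app (app G p.1) p.2)) → FreeFor m G (constToVar m P) →
        Thm Ax (subst m G (constToVar m P)) := by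
  obtain ⟨l, hl, h⟩ := h
  obtain ⟨l, hlS, rfl⟩ : ∃ l' : List (Term C β × Term C α), (∀ p ∈ l', p ∈ S) ∧
      l'.map (fun p => newConstForm c p.1 p.2) = l := by
    choose f hf using hl
    refine ⟨l.attach.map fun Q => f Q.1 Q.2, List.forall_mem_map.2 fun Q _ => (hf Q.1 Q.2).1, ?_⟩
    rw [List.map_map]
    exact (List.map_congr_left fun Q _ => (hf Q.1 Q.2).2).trans l.attach_map_subtype_val
  refine ⟨l, hlS, ?_⟩
  obtain ⟨M, hM⟩ := h.constToVar_of_incl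
  obtain ⟨M', hM'⟩ := exists_varBound_le (l.map fun p => pair p.1 p.2).finite_toSet
  refine ⟨max M M', fun m hm G hG hP => ?_⟩
  have bound : ∀ p ∈ l, varBound (pair p.1 p.2) ≤ m := fun p hp =>
    (hM' _ (List.mem_map_of_mem hp)).trans ((le_max_right M M').trans hm)
  have h_var := hM m ((le_max_left M M').trans hm)
  rw [constToVar, csubst_foldr_imp, List.map_map] at h_var
  have h_G := h_var.subst (i := m) (A := G) <| by
    refine (freeFor_foldr_imp m G _ _).2 ⟨List.forall_mem_map.2 fun p hp => ?_, hP⟩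
    exact freeFor_constToVar_newConstForm G (bound p hp)
  rw [subst_foldr_imp, List.map_map] at h_G
  refine h_G.of_foldr_imp (List.forall_mem_map.2 fun p hp => ?_)
  exact (congrArg (Thm Ax) (subst_constToVar_newConstForm G (bound p hp))).mpr (hG p hp)

end NewConstant

section NewConstantDerivations

variable {n : ℕ} {C : Ty n → Type u} {E : Ty n → Type v} {α β : Ty n} {Ax : Set (Form C)}
  {c : E (Ty.fn β (Ty.fn α Ty.t))}

theorem Thm.listGraph_app_of_mem {m : ℕ} {l : List (Term C β × Term C α)}
    (hl : ∀ p ∈ l, varBound (pair p.1 p.2) ≤ m) {p : Term C β × Term C α} (hp : p ∈ l) :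
    Thm Ax (app (app (listGraph m (l.map fun p => pair p.1 p.2)) p.1) p.2) :=
  (listGraph_app (List.forall_mem_map.2 hl) ((le_max_left _ _).trans (hl p hp)) p.2).symm.eq_mp
    (oneOf_of_mem (List.mem_map_of_mem hp))

variable {S : Set (Term C β × Term C α)}

theorem consistent_newConstAxioms (hAx : ¬ Thm Ax fls) :
    Consistent (incl E '' Ax) (newConstAxioms c S) := by
  intro h
  obtain ⟨l, -, M, hM⟩ := h.exists_replace_newConst
  obtain ⟨M', hM'⟩ := exists_varBound_le (l.map fun p => pair p.1 p.2).finite_toSet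
  have bound : ∀ p ∈ l, varBound (pair p.1 p.2) ≤ max M M' := fun p hp =>
    (hM' _ (List.mem_map_of_mem hp)).trans (le_max_right M M')
  let G := listGraph (max M M') (l.map fun p => pair p.1 p.2)
  have thm_fls : Thm Ax (subst (max M M') G fls) :=
    hM _ (le_max_left M M') G (fun p hp => .listGraph_app_of_mem bound hp) (freeFor_fls _ G)
  exact hAx (subst_fls (max M M') G ▸ thm_fls)

theorem Derives.exists_oneOf {X : Term C β} {A : Term C α}
    (h : Derives (incl E '' Ax) (newConstAxioms c S) (newConstForm c X A)) :
    ∃ l : List (Term C β × Term C α), (∀ p ∈ l, p ∈ S) ∧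
      Thm Ax (oneOf (pair X A) (l.map fun p => pair p.1 p.2)) := by
  obtain ⟨l, hl, M, hM⟩ := h.exists_replace_newConst
  obtain ⟨M', hM'⟩ := exists_varBound_le (((X, A) :: l).map fun p => pair p.1 p.2).finite_toSet
  have bound : ∀ p ∈ (X, A) :: l, varBound (pair p.1 p.2) ≤ max M M' := fun p hp =>
    (hM' _ (List.mem_map_of_mem hp)).trans (le_max_right M M')
  rw [List.forall_mem_cons] at bound
  let G := listGraph (max M M') (l.map fun p => pair p.1 p.2)
  have app_G : Thm Ax (app (app G X) A) := by
    rw [← subst_constToVar_newConstForm (c := c) G bound.1]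
    exact hM _ (le_max_left M M') G (fun p hp => .listGraph_app_of_mem bound.2 hp)
      (freeFor_constToVar_newConstForm G bound.1)
  exact ⟨l, hl, (Thm.listGraph_app (List.forall_mem_map.2 bound.2)
    ((le_max_left _ _).trans bound.1) A).eq_mp app_G⟩

theorem mem_iff_derives {W : Type*} {T : W → Term C β} {L : Set (W × Term C α)}
    (hAx : ¬ Thm Ax fls) (hT : ∀ w w', w ≠ w' → Thm Ax (neg (eq (T w) (T w'))))
    (hL : ∀ w, EqDisjClosed Ax {A | (w, A) ∈ L}) (w : W) (A : Term C α) :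
    (w, A) ∈ L ↔
      Derives (incl E '' Ax) (newConstAxioms c (Prod.map T id '' L)) (newConstForm c (T w) A) := by
  refine ⟨fun hA => .of_mem ⟨_, ⟨_, hA, rfl⟩, rfl⟩, fun h => ?_⟩
  obtain ⟨l, hl, h⟩ := h.exists_oneOf
  classical
  let l' := (l.map Prod.snd).filter fun D => (w, D) ∈ L
  have mem_section : ∀ D ∈ l', (w, D) ∈ L := fun D hD => by simpa using (List.mem_filter.1 hD).2
  refine (hL w).mem_of_oneOf hAx mem_section (Thm.mp (Thm.oneOf_imp ?_) h)
  refine List.forall_mem_map.2 fun p hp => ?_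
  obtain ⟨⟨w', B⟩, hB, rfl⟩ := hl p hp
  by_cases hw : w = w'
  · subst hw
    have mem_l' : B ∈ l' := List.mem_filter.2 ⟨List.mem_map_of_mem hp, by simpa using hB⟩
    exact (Thm.pair_eq_imp_snd _ _ _ _).imp_trans (Thm.eq_imp_oneOf mem_l')
  · exact (Thm.pair_eq_imp_fst _ _ _ _).imp_trans (Thm.imp_of_neg _ (hT w w' hw))

end NewConstantDerivations

theorem exists_append_singleton_split {X : Type*} [Nontrivial X] {w w' : List X} (h : w ≠ w') :
    ∃ (c : X) (u : List X) (a b : X) (v v' : List X), a ≠ b ∧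
      w ++ [c] = u ++ a :: v ∧ w' ++ [c] = u ++ b :: v' := by
  induction w generalizing w' with
  | nil =>
    cases w' with
    | nil => exact absurd rfl h
    | cons b w' =>
      obtain ⟨c, hc⟩ := exists_ne b
      exact ⟨c, [], c, b, [], w' ++ [c], hc, rfl, rfl⟩
  | cons a w ih =>
    cases w' with
    | nil =>
      obtain ⟨c, hc⟩ := exists_ne a
      exact ⟨c, [], a, c, w ++ [c], [], hc.symm, rfl, rfl⟩
    | cons b w' =>
      by_cases hab : a = b
      · subst hab
        obtain ⟨c, u, a', b', v, v', hne, hw, hw'⟩ := ih fun hw => h (congrArg (a :: ·) hw)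
        exact ⟨c, a :: u, a', b', v, v', hne, congrArg (a :: ·) hw, congrArg (a :: ·) hw'⟩
      · exact ⟨a, [], a, b, w ++ [a], w' ++ [a], hab, rfl, rfl⟩

section Words

variable {n : ℕ} [NeZero n] {N : ℕ} {K : Ty n → Type u}

theorem closed_catT {A B : Term (SymConst N K) (symb n)} (hA : Closed A) (hB : Closed B) :
    Closed (catT A B) := by
  intro i γ
  simp only [catT, Free, false_or]
  exact not_or.2 ⟨hA i γ, hB i γ⟩

theorem closed_letterT (a : Fin N) : Closed (letterT a : Term (SymConst N K) (symb n)) :=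
  fun _ _ => id

theorem closed_wordT (w : List (Fin N)) : Closed (wordT w : Term (SymConst N K) (symb n)) := by
  induction w using wordT.induct with
  | case1 => exact fun _ _ => id
  | case2 a => exact closed_letterT a
  | case3 a b w ih => exact closed_catT (closed_letterT a) ih

namespace Thm

theorem catT_congr {Ax : Set (Form (SymConst N K))} {A B A' B' : Term (SymConst N K) (symb n)}
    (h : Thm Ax (eq A A')) (h' : Thm Ax (eq B B')) : Thm Ax (eq (catT A B) (catT A' B')) :=
  app_congr (app_congr (refl _) h) h'

theorem catT_unit (A : Term (SymConst N K) (symb n)) :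
    Thm (symAxioms N K) (conj (eq (catT A epsT) A) (eq (catT epsT A) A)) := by
  simpa [Term.subst, catT, epsT] using
    inst (A := A) (nonlogical (Ax := symAxioms N K) .unit) (by simp [FreeFor, catT, epsT])

theorem catT_epsT (A : Term (SymConst N K) (symb n)) :
    Thm (symAxioms N K) (eq (catT A epsT) A) :=
  mp (taut (.imp (.conj (.var 0) (.var 1)) (.var 0)) (by decide) ![_, _]) (catT_unit A)

theorem epsT_catT (A : Term (SymConst N K) (symb n)) :
    Thm (symAxioms N K) (eq (catT epsT A) A) :=
  mp (taut (.imp (.conj (.var 0) (.var 1)) (.var 1)) (by decide) ![_, _]) (catT_unit A)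

section ClosedTerms

variable {A B D : Term (SymConst N K) (symb n)}

theorem catT_assoc (hA : Closed A) (hB : Closed B) (hD : Closed D) :
    Thm (symAxioms N K) (eq (catT (catT A B) D) (catT A (catT B D))) := by
  simpa [Term.subst, catT, hA.subst_eq, hB.subst_eq] using
    inst_three (nonlogical (Ax := symAxioms N K) .assoc) hA hB hD

theorem catT_letterT_ne_of_lt {i j : Fin N} (hij : i < j) (hA : Closed A) (hB : Closed B)
    (hD : Closed D) :
    Thm (symAxioms N K) (neg (eq (catT (catT A (letterT i)) B) (catT (catT A (letterT j)) D))) := by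
  simpa [Term.subst, catT, letterT, hA.subst_eq, hB.subst_eq] using
    inst_three (nonlogical (Ax := symAxioms N K) (.distinct i j hij)) hA hB hD

theorem catT_letterT_ne {i j : Fin N} (hij : i ≠ j) (hA : Closed A) (hB : Closed B)
    (hD : Closed D) :
    Thm (symAxioms N K) (neg (eq (catT (catT A (letterT i)) B) (catT (catT A (letterT j)) D))) :=
  hij.lt_or_gt.elim (catT_letterT_ne_of_lt · hA hB hD)
    fun hji => neg_eq_symm (catT_letterT_ne_of_lt hji hA hD hB)

end ClosedTerms

theorem wordT_cons (a : Fin N) (w : List (Fin N)) :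
    Thm (symAxioms N K) (eq (wordT (a :: w)) (catT (letterT a) (wordT w))) := by
  cases w with
  | nil => exact (catT_epsT _).symm
  | cons b w => exact refl _

theorem wordT_append (w w' : List (Fin N)) :
    Thm (symAxioms N K) (eq (wordT (w ++ w')) (catT (wordT w) (wordT w'))) := by
  induction w with
  | nil => exact (epsT_catT _).symm
  | cons a w ih =>
    exact ((wordT_cons a (w ++ w')).trans (catT_congr (refl _) ih)).trans
      ((catT_assoc (closed_letterT a) (closed_wordT w) (closed_wordT w')).symm.trans
        (catT_congr (wordT_cons a w).symm (refl _)))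

theorem wordT_append_cons (w : List (Fin N)) (a : Fin N) (v : List (Fin N)) :
    Thm (symAxioms N K)
      (eq (wordT (w ++ a :: v)) (catT (catT (wordT w) (letterT a)) (wordT v))) :=
  ((wordT_append w (a :: v)).trans (catT_congr (refl _) (wordT_cons a v))).trans
    (catT_assoc (closed_wordT w) (closed_letterT a) (closed_wordT v)).symm

theorem wordT_ne_of_split {a b : Fin N} (hab : a ≠ b) (u v v' : List (Fin N)) :
    Thm (symAxioms N K) (neg (eq (wordT (u ++ a :: v)) (wordT (u ++ b :: v')))) :=
  (neg_congr (eq_congr (wordT_append_cons u a v) (wordT_append_cons u b v'))).symm.eq_mp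
    (catT_letterT_ne hab (closed_wordT u) (closed_wordT v) (closed_wordT v'))

theorem wordT_ne_of_append {w w' : List (Fin N)} {c : Fin N}
    (h : Thm (symAxioms N K) (neg (eq (wordT (w ++ [c])) (wordT (w' ++ [c]))))) :
    Thm (symAxioms N K) (neg (eq (wordT w) (wordT w'))) := by
  have append_imp := eq_subst_imp (Ax := symAxioms N K) 0
    (S := catT (var 0 (symb n)) (letterT c)) (closed_wordT w).freeFor (closed_wordT w').freeFor
  simp only [Term.subst, catT, letterT, and_self, dite_true] at append_imp
  exact modus_tollens append_imp
    ((neg_congr (eq_congr (wordT_append w [c]) (wordT_append w' [c]))).eq_mp h)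

theorem wordT_ne (hN : N ≠ 1) {w w' : List (Fin N)} (h : w ≠ w') :
    Thm (symAxioms N K) (neg (eq (wordT w) (wordT w'))) := by
  have : Nontrivial (Fin N) := by
    rw [Fin.nontrivial_iff_two_le]
    have : N ≠ 0 := by
      rintro rfl
      exact h (Subsingleton.elim w w')
    omega
  obtain ⟨c, u, a, b, v, v', hab, hw, hw'⟩ := exists_append_singleton_split h
  refine wordT_ne_of_append (c := c) ?_
  rw [hw, hw']
  exact wordT_ne_of_split hab u v v'

end Thm

end Words

section Semantics

variable {n : ℕ}

/-- The types of the standard frame in which the `i`-th individual type denotes the set `X i`. -/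
def Sem (X : Fin n → Type) : Ty n → Type
  | Ty.t => Prop
  | Ty.e i => X i
  | Ty.fn α β => Sem X α → Sem X β
  | Ty.prod α β => Sem X α × Sem X β

instance Sem.instNonempty (X : Fin n → Type) [∀ i, Nonempty (X i)] : ∀ α : Ty n, Nonempty (Sem X α)
  | Ty.t => ⟨True⟩
  | Ty.e i => inferInstanceAs (Nonempty (X i))
  | Ty.fn _ β => ⟨fun _ => (instNonempty X β).some⟩
  | Ty.prod α β => ⟨((instNonempty X α).some, (instNonempty X β).some)⟩

/-- Assignments of values to the variables. -/
abbrev Assignment (X : Fin n → Type) : Type := ∀ p : ℕ × Ty n, Sem X p.2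

variable {C : Ty n → Type u} {X : Fin n → Type} [∀ i, Nonempty (X i)]

/-- The denotation of a term in the standard model given by the interpretation `I` of the
constants, under an assignment. The description operators choose an element of their argument. -/
noncomputable def denote (I : ∀ α : Ty n, C α → Sem X α) :
    {β : Ty n} → Term C β → Assignment X → Sem X β
  | _, var i α, ρ => ρ (i, α)
  | _, const c, _ => I _ c
  | _, iota α, _ => fun P : Sem X α → Prop => Classical.epsilon P
  | _, app A B, ρ => denote I A ρ (denote I B ρ)
  | _, lam i α A, ρ => fun x => denote I A (Function.update ρ (i, α) x)
  | _, eq A B, ρ => denote I A ρ = denote I B ρ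
  | _, pair A B, ρ => (denote I A ρ, denote I B ρ)
  | _, fst A, ρ => (denote I A ρ).1
  | _, snd A, ρ => (denote I A ρ).2

variable {I : ∀ α : Ty n, C α → Sem X α}

theorem denote_congr {β : Ty n} {A : Term C β} {ρ ρ' : Assignment X}
    (h : ∀ i α, Free i α A → ρ (i, α) = ρ' (i, α)) : denote I A ρ = denote I A ρ' := by
  induction A generalizing ρ ρ' with
  | var j γ => exact h j γ ⟨rfl, rfl⟩
  | const c => rfl
  | iota γ => rfl
  | lam j γ A ih =>
    funext x
    refine ih fun i α hA => ?_
    by_cases hij : (i, α) = (j, γ)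
    · cases hij; simp only [Function.update_self]
    · rw [Function.update_of_ne hij, Function.update_of_ne hij]
      exact h i α ⟨fun hji => hij (Prod.ext hji.1.symm hji.2.symm), hA⟩
  | app A B ihA ihB | eq A B ihA ihB | pair A B ihA ihB =>
    simp only [denote]
    rw [ihA fun i α hA => h i α (.inl hA), ihB fun i α hB => h i α (.inr hB)]
  | fst A ih | snd A ih => simp only [denote, ih h]

theorem denote_update {i : ℕ} {α β : Ty n} {A : Term C β} (h : ¬ Free i α A) (ρ : Assignment X)
    (x : Sem X α) : denote I A (Function.update ρ (i, α) x) = denote I A ρ := by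
  refine denote_congr fun j γ hA => Function.update_of_ne (fun hij => h ?_) _ _
  cases hij
  exact hA

theorem denote_subst {i : ℕ} {α β : Ty n} {B : Term C α} {A : Term C β} (h : FreeFor i B A)
    (ρ : Assignment X) :
    denote I (subst i B A) ρ = denote I A (Function.update ρ (i, α) (denote I B ρ)) := by
  induction A generalizing ρ with
  | var j γ =>
    simp only [subst]
    split_ifs with hj
    · obtain ⟨rfl, rfl⟩ := hj; simp only [denote, Function.update_self]
    · simp only [denote]
      rw [Function.update_of_ne fun hij => hj ?_]
      cases hij; exact ⟨rfl, rfl⟩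
  | const c => rfl
  | iota γ => rfl
  | lam j γ A ih =>
    by_cases hA : Free i α (lam j γ A)
    · obtain ⟨hB, hA'⟩ := (h.resolve_left hA.1).resolve_left (not_not_intro hA.2)
      simp only [subst, if_neg hA.1, denote]
      funext x
      rw [ih hA', denote_update hB, Function.update_comm]
      exact fun hij => hA.1 (Prod.mk.inj hij)
    · rw [subst_of_not_free hA, denote_update hA]
  | app A A' ihA ihB | eq A A' ihA ihB | pair A A' ihA ihB =>
    simp only [subst, denote]
    rw [ihA h.1, ihB h.2]
  | fst A ih | snd A ih => simp only [subst, denote, ih h]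

theorem denote_replace {α β : Ty n} {A B : Term C α} {P Q : Term C β} (h : Replace A B P Q)
    (hAB : ∀ ρ, denote I A ρ = denote I B ρ) (ρ : Assignment X) :
    denote I P ρ = denote I Q ρ := by
  induction h generalizing ρ with
  | here => exact hAB ρ
  | lam _ _ _ ih => exact funext fun _ => ih _
  | appL _ _ ih | appR _ _ ih | eqL _ _ ih | eqR _ _ ih | pairL _ _ ih | pairR _ _ ih | fst _ ih
  | snd _ ih => simp only [denote]; rw [ih ρ]

section LogicalSymbols

variable (ρ : Assignment X)

theorem denote_tru : denote I (tru : Form C) ρ = True := eq_true rfl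

theorem denote_all (i : ℕ) (α : Ty n) (P : Form C) :
    denote I (all i α P) ρ = ∀ x, denote I P (Function.update ρ (i, α) x) := by
  simp only [all, denote, denote_tru]
  refine propext ⟨fun h x => (congrFun h x).mp trivial, fun h => ?_⟩
  funext x
  exact (eq_true (h x)).symm

theorem denote_fls : denote I (fls : Form C) ρ = False := by
  rw [fls, denote_all]
  exact eq_false fun h => (Function.update_self (0, Ty.t) _ ρ).mp (h False)

theorem denote_neg (P : Form C) : denote I (neg P) ρ = ¬ denote I P ρ := by
  simp only [neg, denote, denote_fls]
  exact propext ⟨fun h hP => h.mpr hP, fun h => (eq_false h).symm⟩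

theorem denote_conj (P Q : Form C) :
    denote I (conj P Q) ρ = (denote I P ρ ∧ denote I Q ρ) := by
  have unfolded : denote I (conj P Q) ρ = ((fun g : Prop → Prop → Prop => g True True) =
      fun g => g (denote I P ρ) (denote I Q ρ)) := by
    simp only [conj, conjOp, denote, denote_tru, Function.update_self]
    rfl
  rw [unfolded]
  refine propext ⟨fun h => (congrFun h And).mp ⟨trivial, trivial⟩, fun h => ?_⟩
  rw [eq_true h.1, eq_true h.2]

theorem denote_imp (P Q : Form C) :
    denote I (imp P Q) ρ = (denote I P ρ → denote I Q ρ) := by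
  have unfolded : denote I (imp P Q) ρ = (denote I P ρ = (denote I P ρ ∧ denote I Q ρ)) :=
    congrArg (denote I P ρ = ·) (denote_conj ρ P Q)
  rw [unfolded]
  exact propext (eq_iff_iff.trans iff_self_and)

end LogicalSymbols

theorem Thm.sound {Ax : Set (Form C)} (hAx : ∀ Q ∈ Ax, ∀ ρ, denote I Q ρ) {P : Form C}
    (h : Thm Ax P) (ρ : Assignment X) : denote I P ρ := by
  induction h generalizing ρ with
  | nonlogical h => exact hAx _ h ρ
  | truthValues i G hG =>
    simp only [denote, denote_conj, denote_all, denote_tru, denote_fls, denote_update hG,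
      Function.update_self]
    refine propext ⟨fun h (x : Prop) => ?_, fun h => ⟨h True, h False⟩⟩
    by_cases hx : x
    · rw [eq_true hx]; exact h.1
    · rw [eq_false hx]; exact h.2
  | leibniz A B H =>
    rw [denote_imp]
    exact congrArg (denote I H ρ)
  | extensionality i F G hF hG =>
    simp only [denote, denote_all, Function.update_self, denote_update hF, denote_update hG]
    exact propext funext_iff
  | beta i A B hB => exact (denote_subst hB ρ).symm
  | description i A hA =>
    simp only [denote, Function.update_self, denote_update hA]
    exact (Classical.epsilon_spec (p := fun x => denote I A ρ = x) ⟨_, rfl⟩).symm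
  | fstPair A B | sndPair A B | pairProj A => rfl
  | replace _ _ hr ih ih' => exact (denote_replace hr ih ρ).mp (ih' ρ)

end Semantics

section WordModel

variable {n : ℕ} [NeZero n] {N : ℕ} {K : Ty n → Type u}

/-- The interpretation of the constants of the symbolic type by words; all individual types denote
the set of words, and the further constants denote arbitrary elements. -/
noncomputable def wordInterp :
    ∀ α : Ty n, SymConst N K α → Sem (fun _ : Fin n => List (Fin N)) α
  | _, .cat => fun x y : List (Fin N) => x ++ y
  | _, .eps => ([] : List (Fin N))
  | _, .letter i => [i]
  | _, .other _ => Classical.arbitrary _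

theorem denote_wordInterp_of_mem_symAxioms {P : Form (SymConst N K)} (h : P ∈ symAxioms N K)
    (ρ : Assignment fun _ : Fin n => List (Fin N)) : denote wordInterp P ρ := by
  cases h with
  | unit =>
    simp only [denote_all, denote_conj]
    exact fun _ => ⟨List.append_nil (α := Fin N) _, rfl⟩
  | assoc =>
    simp only [denote_all]
    exact fun _ _ _ => List.append_assoc (α := Fin N) _ _ _
  | distinct i j hij =>
    have words_ne (x y z : List (Fin N)) : x ++ [i] ++ y ≠ x ++ [j] ++ z := by
      simp only [List.append_assoc, List.singleton_append, ne_eq, List.append_cancel_left_eq,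
        List.cons.injEq, hij.ne, false_and, not_false_eq_true]
    simp only [denote_all, denote_neg]
    exact fun _ _ _ => words_ne _ _ _

theorem not_thm_symAxioms_fls : ¬ Thm (symAxioms N K) fls := fun h =>
  (denote_fls _).mp (h.sound (fun _ => denote_wordInterp_of_mem_symAxioms)
    (Classical.arbitrary (Assignment fun _ : Fin n => List (Fin N))))

end WordModel

section Representability

variable {n : ℕ} [NeZero n] {N : ℕ} {K : Ty n → Type u} {α : Ty n} {L : Lang N K α}

theorem Representable.logicallyClosed (hL : Representable.{u, v} L) : LogicallyClosed L := by
  obtain ⟨E, Δ, R, -, hR⟩ := hL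
  intro w A B D hB hD h
  have lifted : Thm (extAxioms N K E)
      (disj (eq (lift E A) (lift E B)) (eq (lift E A) (lift E D))) := h.map fun _ => Sum.inl
  exact (hR w A).2 (.app_of_disj lifted ((hR w B).1 hB) ((hR w D).1 hD))

theorem langAxioms_eq_newConstAxioms (E : Ty n → Type v) (c : E (Ty.fn (symb n) (Ty.fn α Ty.t)))
    (L : Lang N K α) : langAxioms E c L = newConstAxioms c (Prod.map wordT id '' L) := by
  ext P
  simp only [langAxioms, newConstAxioms, Set.mem_ofPred_eq, Set.exists_mem_image, Prod.exists,
    eq_comm]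
  rfl

theorem LogicallyClosed.representedBy (hL : LogicallyClosed L) (hN : N ≠ 1) (E : Ty n → Type v)
    (c : E (Ty.fn (symb n) (Ty.fn α Ty.t))) :
    RepresentedBy E (langAxioms E c L) (const (Sum.inr c)) L := by
  rw [langAxioms_eq_newConstAxioms]
  exact ⟨consistent_newConstAxioms not_thm_symAxioms_fls,
    mem_iff_derives not_thm_symAxioms_fls (fun _ _ => Thm.wordT_ne hN) hL⟩

end Representability

end TyN

theorem theorem5p5 {n : ℕ} [NeZero n] (N : ℕ) (K : TyN.Ty n → Type u) (α : TyN.Ty n)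
    (L : TyN.Lang N K α) :
    (TyN.Representable.{u, v} L → TyN.LogicallyClosed L) ∧
    (N ≠ 1 → TyN.LogicallyClosed L →
      ∀ (E : TyN.Ty n → Type v) (c : E (TyN.Ty.fn (TyN.symb n) (TyN.Ty.fn α TyN.Ty.t))),
        TyN.RepresentedBy E (TyN.langAxioms E c L) (TyN.Term.const (Sum.inr c)) L) ∧
    (N ≠ 1 → (TyN.Representable.{u, v} L ↔ TyN.LogicallyClosed L)) :=
  ⟨TyN.Representable.logicallyClosed, fun hN hL E c => hL.representedBy hN E c, fun hN =>
    ⟨TyN.Representable.logicallyClosed, fun hL =>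
      ⟨fun _ => PUnit, _, _, hL.representedBy hN (fun _ => PUnit) PUnit.unit⟩⟩⟩
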